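/- Consider $M$ clients holding $N$ data points in total. Client $i\in[M]$ holds $n_i\ge 1$ samples $(x_{ij},y_{ij})$, $j\in[n_i]$, with $\sum_{i=1}^M n_i=N$ and $$y_{ij}=x_{ij}^\top B\alpha_i+\xi_{ij},\qquad x_{ij}\sim N(0,I_d),\quad \xi_{ij}\sim N(0,1)\quad\text{all independent},$$ where $B\in\mathcal O^{d\times k}=\{B\in\mathbb R^{d\times k}:B^\top B=I_k\}$ and $\alpha_i\in\mathbb R^k$. For $B,B'\in\mathcal O^{d\times k}$ let $\|\sin\Theta(B,B')\|=\|BB^\top-B'B'^\top\|$ (spectral norm). For $\lambda_1\ge\lambda_k>0$ and constants $A>0$, $0<c_D\le C_D$, let $$\Psi_{\lambda_1,\lambda_k}=\Big\{(\alpha,\vec n):\ \alpha_i\in\mathbb R^k,\ \|\alpha_i\|\le A,\ n_i\in\mathbb Z,\ n_i\ge 1\ \ \forall i\in[M],\ \ \sum_{i=1}^M n_i=N,\ \ c_D\lambda_k I_k\preceq\frac1N\sum_{i=1}^M n_i\alpha_i\alpha_i^\top\preceq C_D\lambda_1 I_k\Big\}.$$ **Theorem.** Let $b>0$ and $c_D>0$.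 There is $A_0>0$, depending only on $b$ and $c_D$, such that for every $A\ge A_0$ and all $C_D\ge c_D$ and $a,c_0,\rho_1,\rho_2>0$ there is a constant $c>0$, depending only on $a,b,A,c_D,C_D,c_0,\rho_1,\rho_2$, with the following property. For all integers $d,k,M,N$ and reals $\lambda_1,\lambda_k$ with $$k\ge 1,\quad k\ge c_0\log M,\quad d\ge(1+\rho_1)k,\quad M\ge(1+\rho_2)k,\quad N\ge M,\quad \frac ak\le\lambda_k\le\lambda_1\le\frac bk$$ (that is, $\lambda_1=\Theta(\lambda_k)=\Theta(1/k)$), one has $$\inf_{\widehat B}\ \sup_{B\in\mathcal O^{d\times k}}\ \sup_{(\alpha,\vec n)\in\Psi_{\lambda_1,\lambda_k}}\ \mathbb E\big[\|\sin\Theta(\widehat B,B)\|\big]\ \ge\ c\,\bigg(\Big(\sqrt{\tfrac{dk}{N}}+\sqrt{\tfrac{Mdk^2}{N^2}}\Big)\wedge 1\bigg),$$ where the infimum is over all estimators $\widehat B\in\mathcal O^{d\times k}$ (possibly randomized) based on the data $\{(x_{ij},y_{ij})\}$, which include the sample sizes $n_i$. -/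

import Mathlib

open MeasureTheory ProbabilityTheory
open scoped ENNReal

/-- `𝒪^{d×k}`: the `d × k` real matrices with orthonormal columns. -/
def OrthoMat (d k : ℕ) : Type :=
  {B : Matrix (Fin d) (Fin k) ℝ // B.transpose * B = 1}

/-- The Borel σ-algebra of `𝒪^{d×k}`, generated by the matrix entries. -/
instance OrthoMat.instMeasurableSpace (d k : ℕ) : MeasurableSpace (OrthoMat d k) :=
  MeasurableSpace.comap (fun (B : OrthoMat d k) (i : Fin d) (j : Fin k) => B.1 i j)
    MeasurableSpace.pi

/-- Principal angle distance `‖sin Θ(B, B')‖ = ‖B Bᵀ - B' B'ᵀ‖`, in the spectral norm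
(the operator norm for the Euclidean norm). -/
noncomputable def sinTheta {d k : ℕ} (B B' : OrthoMat d k) : ℝ :=
  ‖Matrix.toEuclideanCLM (𝕜 := ℝ) (B.1 * B.1.transpose - B'.1 * B'.1.transpose)‖

/-- The whole dataset: client `i` holds the `n i` pairs `(x_{ij}, y_{ij}) ∈ ℝ^d × ℝ`. -/
abbrev Dataset (d : ℕ) {M : ℕ} (n : Fin M → ℕ) : Type :=
  (i : Fin M) → Fin (n i) → EuclideanSpace ℝ (Fin d) × ℝ

/-- The law of one sample `(x, y)` of a client with parameter `θ`:
`y = xᵀ θ + ξ` with `x ∼ N(0, I_d)` and `ξ ∼ N(0, 1)` independent. -/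
noncomputable def sampleLaw {d : ℕ} (θ : EuclideanSpace ℝ (Fin d)) :
    Measure (EuclideanSpace ℝ (Fin d) × ℝ) :=
  ((stdGaussian (EuclideanSpace ℝ (Fin d))).prod (gaussianReal 0 1)).map
    (fun p => (p.1, inner ℝ p.1 θ + p.2))

/-- The client parameter `θ_i = B α_i` (the covariates have identity covariance). -/
noncomputable def clientParam {d k : ℕ} (B : OrthoMat d k) (a : EuclideanSpace ℝ (Fin k)) :
    EuclideanSpace ℝ (Fin d) :=
  WithLp.toLp 2 (B.1.mulVec a.ofLp)

/-- The law of the dataset: all samples are independent. -/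
noncomputable def dataLaw {d k M : ℕ} (B : OrthoMat d k)
    (α : Fin M → EuclideanSpace ℝ (Fin k)) (n : Fin M → ℕ) : Measure (Dataset d n) :=
  Measure.pi fun i => Measure.pi fun _ => sampleLaw (clientParam B (α i))

/-- The client diversity matrix `D = (1/N) ∑ i, n_i α_i α_iᵀ`, where `N = ∑ i, n_i`. -/
noncomputable def diversityMatrix {k M : ℕ} (α : Fin M → EuclideanSpace ℝ (Fin k))
    (n : Fin M → ℕ) : Matrix (Fin k) (Fin k) ℝ :=
  (1 / ((∑ i, n i : ℕ) : ℝ)) •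
    ∑ i, (n i : ℝ) • Matrix.vecMulVec (α i).ofLp (α i).ofLp

/-- The parameter space `Ψ_{λ₁, λ_k}` of pairs `(α, n)`; the implied constants are
`A` in `‖α_i‖ = O(1)`, and `cD`, `CD` in `Ω(λ_k) I ⪯ D ⪯ O(λ₁) I`. -/
def paramSpace (k M N : ℕ) (A cD CD lam1 lamk : ℝ) :
    Set ((Fin M → EuclideanSpace ℝ (Fin k)) × (Fin M → ℕ)) :=
  {p | (∀ i, ‖p.1 i‖ ≤ A) ∧ (∀ i, 1 ≤ p.2 i) ∧ ∑ i, p.2 i = N ∧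
    (diversityMatrix p.1 p.2 - (cD * lamk) • (1 : Matrix (Fin k) (Fin k) ℝ)).PosSemidef ∧
    ((CD * lam1) • (1 : Matrix (Fin k) (Fin k) ℝ) - diversityMatrix p.1 p.2).PosSemidef}

/-- A (possibly randomized) estimator of `B`. It may depend on the sample sizes, which are
visible in the data, and maps a dataset to a probability law on `𝒪^{d×k}`; measurable
functions of the data are the special case of Dirac laws. -/
structure Estimator (d k M : ℕ) where
  kernel : (n : Fin M → ℕ) → Kernel (Dataset d n) (OrthoMat d k)
  isMarkov : ∀ n, IsMarkovKernel (kernel n)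

/-- The risk `E[‖sin Θ(B̂, B)‖]`, the expectation over the data and over the estimator's own
randomness, as a number in `[0, ∞]`. -/
noncomputable def risk {d k M : ℕ} (est : Estimator d k M) (B : OrthoMat d k)
    (α : Fin M → EuclideanSpace ℝ (Fin k)) (n : Fin M → ℕ) : ℝ≥0∞ :=
  ∫⁻ data, ∫⁻ Bhat, ENNReal.ofReal (sinTheta Bhat B) ∂(est.kernel n data) ∂(dataLaw B α n)

/-- The minimax risk `inf_{B̂} sup_B sup_{(α, n) ∈ Ψ} E[‖sin Θ(B̂, B)‖]`. -/
noncomputable def minimaxRisk (d k M N : ℕ) (A cD CD lam1 lamk : ℝ) : ℝ≥0∞ :=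
  ⨅ est : Estimator d k M, ⨆ B : OrthoMat d k, ⨆ p ∈ paramSpace k M N A cD CD lam1 lamk,
    risk est B p.1 p.2

/-! The rate is, up to constants, the larger of `X = √(dk/N)` and `Y = √(Mdk²/N²)`. Each is obtained
by Assouad's method on one family of matrices. Their first column has a fixed entry `c` in
coordinate `0` and hidden signs `±η` in the coordinates `i ≥ k`; the other columns are fixed
coordinate vectors. With `ε = η√(d-k)` and `c² = 1 - ε²`, every wrong sign costs `cη/√(d-k)` in
`sinTheta` (`sinTheta_planted_ge`). If flipping one sign changes the data law by a chi-square
divergence of at most `1/4`, a constant fraction of the `d - k` signs is lost on average and the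
risk is of order `ε` (`assouad`, `minimaxRisk_ge_of_sqDensityLE`).

Every client sees at most one direction, so only `p` clients, with `n₀` samples each and squared
signal `ω`, carry information on the first column. Put `β = cD * lamk`, of order `1/k`. The
diversity constraint is met with equality by `p n₀ ω = Nβ`.

Known client signs: a flip has divergence of order `p n₀ ω η² = Nβη²`, which allows `ε² ≈ d/(Nβ)`,
that is `X` (`minimaxRisk_ge_known`).

Random client signs: the parameters are `±√ω` times the first column, and the data law is a mixture
over the signs. The mixture of `N(a, I)` and `N(-a, I)` has no first-order term in `a`, so the
divergence per client drops to order `(n₀ω)²η²` as long as `n₀ω` is bounded (`SqDensityLE.signMix`).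
The total is `(Nβ)²η²/p`, and `p` proportional to `M` allows `ε² ≈ Md/(Nβ)²`, that is `Y`
(`minimaxRisk_ge_unknown`).

Since `Y² = X² · Mk/N`, the second bound is needed only when `N ≤ Mk` and `k` is large, which is
where its requirements on `n₀ω` and `ω` hold. -/

/-! ### Product measures and half-half mixtures -/

section PiMeasure

variable {ι : Type*} [Fintype ι] {E : ι → Type*} [∀ i, MeasurableSpace (E i)]

lemma lintegral_pi_prod (μ : ∀ i, Measure (E i)) [∀ i, IsProbabilityMeasure (μ i)]
    (f : ∀ i, E i → ℝ≥0∞) (hf : ∀ i, Measurable (f i)) :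
    ∫⁻ x, ∏ i, f i (x i) ∂(Measure.pi μ) = ∏ i, ∫⁻ x, f i x ∂(μ i) := by
  rw [lintegral_prod_eq_prod_lintegral_of_indepFun Finset.univ (fun i (x : ∀ i, E i) => f i (x i))
    (iIndepFun_pi (fun i => (hf i).aemeasurable)) (fun i => (hf i).comp (measurable_pi_apply i))]
  refine Finset.prod_congr rfl fun i _ => ?_
  exact (measurePreserving_eval μ i).lintegral_comp (hf i)

lemma pi_withDensity (μ : ∀ i, Measure (E i)) [∀ i, IsProbabilityMeasure (μ i)]
    (f : ∀ i, E i → ℝ≥0∞) (hf : ∀ i, Measurable (f i))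
    [∀ i, IsProbabilityMeasure ((μ i).withDensity (f i))] :
    Measure.pi (fun i => (μ i).withDensity (f i)) =
      (Measure.pi μ).withDensity (fun x => ∏ i, f i (x i)) := by
  refine Measure.pi_eq fun s hs => ?_
  rw [withDensity_apply _ (MeasurableSet.univ_pi hs), ← lintegral_indicator (MeasurableSet.univ_pi hs)]
  have h : ∀ x : ∀ i, E i, (Set.univ.pi s).indicator (fun x => ∏ i, f i (x i)) x =
      ∏ i, (s i).indicator (f i) (x i) := by
    intro x
    by_cases hx : x ∈ Set.univ.pi s
    · rw [Set.indicator_of_mem hx]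
      exact Finset.prod_congr rfl fun i _ => (Set.indicator_of_mem (hx i trivial) _).symm
    · rw [Set.indicator_of_notMem hx]
      simp only [Set.mem_univ_pi, not_forall] at hx
      obtain ⟨i, hi⟩ := hx
      exact (Finset.prod_eq_zero (Finset.mem_univ i) (Set.indicator_of_notMem hi _)).symm
  simp_rw [h]
  rw [lintegral_pi_prod μ _ fun i => (hf i).indicator (hs i)]
  refine Finset.prod_congr rfl fun i _ => ?_
  rw [withDensity_apply _ (hs i), lintegral_indicator (hs i)]

/-- The half-half mixture of two measures. -/
noncomputable def halfMix {Ω : Type*} [MeasurableSpace Ω] (μ : Bool → Measure Ω) : Measure Ω :=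
  (2⁻¹ : ℝ≥0∞) • (μ true + μ false)

instance halfMix.isProbabilityMeasure {Ω : Type*} [MeasurableSpace Ω] (μ : Bool → Measure Ω)
    [∀ b, IsProbabilityMeasure (μ b)] : IsProbabilityMeasure (halfMix μ) := by
  constructor
  simp only [halfMix, Measure.smul_apply, Measure.add_apply, measure_univ, smul_eq_mul]
  rw [one_add_one_eq_two, ENNReal.inv_mul_cancel] <;> simp

/-- Expanding the product over coordinates gives one term per choice of halves. A Bayes average over
independent client signs thereby becomes a uniform average over fixed sign patterns. -/
lemma pi_halfMix [DecidableEq ι] (μ : ∀ i, Bool → Measure (E i))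
    [∀ i b, IsProbabilityMeasure (μ i b)] :
    Measure.pi (fun i => halfMix (μ i)) =
      (2⁻¹ : ℝ≥0∞) ^ (Fintype.card ι) • ∑ τ : ι → Bool, Measure.pi (fun i => μ i (τ i)) := by
  refine Measure.pi_eq fun s hs => ?_
  simp only [halfMix, Measure.smul_apply, Measure.coe_finsetSum, Finset.sum_apply, Measure.pi_pi,
    smul_eq_mul, Measure.add_apply]
  rw [Finset.prod_mul_distrib, Finset.prod_const, Finset.card_univ]
  congr 1
  have := Finset.prod_univ_sum (fun _ : ι => (Finset.univ : Finset Bool))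
    (fun i b => μ i b (s i))
  rw [← Fintype.piFinset_univ, ← this]
  refine Finset.prod_congr rfl fun i _ => ?_
  simp

end PiMeasure

/-! ### Chi-square control: tensorization and testing -/

section SqDensity

/-- `P` has a density with respect to `Q` whose second moment under `Q` is at most `κ`, i.e. the
chi-square divergence of `P` from `Q` is at most `κ - 1`. -/
def SqDensityLE {Ω : Type*} [MeasurableSpace Ω] (P Q : Measure Ω) (κ : ℝ≥0∞) : Prop :=
  ∃ L : Ω → ℝ≥0∞, Measurable L ∧ P = Q.withDensity L ∧ ∫⁻ x, L x ^ 2 ∂Q ≤ κ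

variable {Ω : Type*} [MeasurableSpace Ω]

lemma SqDensityLE.refl (Q : Measure Ω) [IsProbabilityMeasure Q] : SqDensityLE Q Q 1 :=
  ⟨fun _ => 1, measurable_const, by simp, by simp⟩

lemma SqDensityLE.mono {P Q : Measure Ω} {κ κ' : ℝ≥0∞} (h : SqDensityLE P Q κ) (hκ : κ ≤ κ') :
    SqDensityLE P Q κ' := by
  obtain ⟨L, h1, h2, h3⟩ := h
  exact ⟨L, h1, h2, h3.trans hκ⟩

lemma SqDensityLE.pi {ι : Type*} [Fintype ι] {E : ι → Type*} [∀ i, MeasurableSpace (E i)]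
    {P Q : ∀ i, Measure (E i)} [∀ i, IsProbabilityMeasure (P i)] [∀ i, IsProbabilityMeasure (Q i)]
    {κ : ι → ℝ≥0∞} (h : ∀ i, SqDensityLE (P i) (Q i) (κ i)) :
    SqDensityLE (Measure.pi P) (Measure.pi Q) (∏ i, κ i) := by
  choose L h1 h2 h3 using h
  have h2' : P = fun i => (Q i).withDensity (L i) := funext h2
  have : ∀ i, IsProbabilityMeasure ((Q i).withDensity (L i)) := fun i => by
    rw [← h2 i]; infer_instance
  refine ⟨fun x => ∏ i, L i (x i), ?_, ?_, ?_⟩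
  · exact Finset.measurable_prod _ fun i _ => (h1 i).comp (measurable_pi_apply i)
  · conv_lhs => rw [h2']
    exact pi_withDensity Q L h1
  · simp_rw [← Finset.prod_pow]
    rw [lintegral_pi_prod Q (fun i x => L i x ^ 2) fun i => (h1 i).pow_const 2]
    exact Finset.prod_le_prod' fun i _ => h3 i

/-- For `0 ≤ φ ≤ 1` one has `φ(L - 1) ≤ (L - 1)² + 1/4`, and the right side integrates to at most
`1/4 + 1/4`. -/
lemma SqDensityLE.lintegral_le {P Q : Measure Ω} [IsProbabilityMeasure P] [IsProbabilityMeasure Q]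
    (h : SqDensityLE P Q (ENNReal.ofReal (5 / 4))) {φ : Ω → ℝ≥0∞} (hφ : Measurable φ)
    (hφ1 : ∀ x, φ x ≤ 1) :
    ∫⁻ x, φ x ∂P ≤ ∫⁻ x, φ x ∂Q + 2⁻¹ := by
  obtain ⟨L, h1, h2, h3⟩ := h
  have hL : ∫⁻ x, L x ∂Q = 1 := by
    have := measure_univ (μ := P)
    rwa [h2, withDensity_apply _ MeasurableSet.univ, setLIntegral_univ] at this
  -- The inequality above with all negative terms moved across, since subtraction in `ℝ≥0∞`
  -- truncates.
  have key : ∀ x, φ x * L x + 2 * L x ≤ φ x + (L x ^ 2 + ENNReal.ofReal (5 / 4)) := by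
    intro x
    rcases eq_or_ne (L x) ⊤ with hx | hx
    · simp [hx]
    obtain ⟨l, hl, hl'⟩ : ∃ l : ℝ, 0 ≤ l ∧ L x = ENNReal.ofReal l :=
      ⟨(L x).toReal, ENNReal.toReal_nonneg, (ENNReal.ofReal_toReal hx).symm⟩
    obtain ⟨f, hf, hf'⟩ : ∃ f : ℝ, 0 ≤ f ∧ φ x = ENNReal.ofReal f :=
      ⟨(φ x).toReal, ENNReal.toReal_nonneg,
        (ENNReal.ofReal_toReal ((hφ1 x).trans_lt ENNReal.one_lt_top).ne).symm⟩
    have hf1 : f ≤ 1 := by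
      have := hφ1 x
      rw [hf'] at this
      simpa using this
    rw [hl', hf', show (2 : ℝ≥0∞) = ENNReal.ofReal 2 by simp, ← ENNReal.ofReal_mul hf,
      ← ENNReal.ofReal_mul (by norm_num), ← ENNReal.ofReal_pow hl,
      ← ENNReal.ofReal_add (by positivity) (by positivity),
      ← ENNReal.ofReal_add (by positivity) (by positivity),
      ← ENNReal.ofReal_add (by positivity) (by positivity)]
    apply ENNReal.ofReal_le_ofReal
    nlinarith [sq_nonneg (l - 3 / 2), sq_nonneg (l - 1), sq_nonneg (l - 1 / 2),
      mul_nonneg hf hl, mul_nonneg (sub_nonneg.2 hf1) hl, mul_nonneg (sub_nonneg.2 hf1) (sq_nonneg (l-1)),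
      mul_nonneg hf (sq_nonneg (l-3/2)), mul_nonneg (sub_nonneg.2 hf1) (sq_nonneg (l-3/2))]
  have h4 := lintegral_mono (μ := Q) key
  rw [lintegral_add_left (show Measurable fun x => φ x * L x from hφ.mul h1), lintegral_add_left hφ, lintegral_add_left (h1.pow_const 2),
    lintegral_const_mul _ h1, hL, lintegral_const, measure_univ, mul_one, mul_one] at h4
  have h5 : ∫⁻ x, φ x ∂P = ∫⁻ x, φ x * L x ∂Q := by
    rw [h2, lintegral_withDensity_eq_lintegral_mul _ h1 hφ]
    simp [mul_comm]
  rw [h5]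
  have h6 : ∫⁻ x, φ x * L x ∂Q + 2 ≤ (∫⁻ x, φ x ∂Q + 2⁻¹) + 2 := by
    refine h4.trans ?_
    rw [add_assoc]
    refine add_le_add le_rfl ((add_le_add h3 le_rfl).trans ?_)
    rw [← ENNReal.ofReal_add (by norm_num) (by norm_num),
      show (2⁻¹ + 2 : ℝ≥0∞) = ENNReal.ofReal (5 / 2) by
        rw [show (5 / 2 : ℝ) = 2⁻¹ + 2 by norm_num, ENNReal.ofReal_add (by norm_num) (by norm_num),
          ENNReal.ofReal_inv_of_pos (by norm_num)]
        simp]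
    exact ENNReal.ofReal_le_ofReal (by norm_num)
  exact (ENNReal.add_le_add_iff_right (by simp)).1 h6

end SqDensity

/-! ### Exponential moments of squared Gaussians -/

section GaussianMoments

lemma one_le_one_sub_mul_exp {T : ℝ} (h0 : 0 ≤ T) (h1 : T ≤ 1 / 4) :
    1 ≤ (1 - 2 * T) * Real.exp (4 * T) := by
  have := Real.add_one_le_exp (4 * T)
  nlinarith

/-- The integral equals `(1 - 2T)^(-1/2)`, and `1/(1 - 2T) ≤ exp (4T)` on this range of `T`. -/
lemma lintegral_exp_sq_gaussianReal {T : ℝ} (h0 : 0 ≤ T) (h1 : T ≤ 1 / 4) :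
    ∫⁻ z, ENNReal.ofReal (Real.exp (T * z ^ 2)) ∂(gaussianReal 0 1) ≤
      ENNReal.ofReal (Real.exp (2 * T)) := by
  have hb : 0 < 1 / 2 - T := by linarith
  have hpdf : ∀ z : ℝ, gaussianPDFReal 0 1 z * Real.exp (T * z ^ 2) =
      (√(2 * Real.pi))⁻¹ * Real.exp (-(1 / 2 - T) * z ^ 2) := by
    intro z
    simp only [gaussianPDFReal, NNReal.coe_one, mul_one, sub_zero]
    rw [mul_assoc, ← Real.exp_add]
    congr 2
    ring
  rw [gaussianReal_of_var_ne_zero _ one_ne_zero,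
    lintegral_withDensity_eq_lintegral_mul _ (measurable_gaussianPDF 0 1) (by fun_prop)]
  simp only [Pi.mul_apply, gaussianPDF]
  simp_rw [← ENNReal.ofReal_mul (gaussianPDFReal_nonneg 0 1 _), hpdf]
  rw [← ofReal_integral_eq_lintegral_ofReal ((integrable_exp_neg_mul_sq hb).const_mul _)
    (ae_of_all _ fun z => by positivity), integral_const_mul, integral_gaussian]
  apply ENNReal.ofReal_le_ofReal
  rw [← Real.sqrt_inv, ← Real.sqrt_mul (by positivity)]
  rw [Real.sqrt_le_left (by positivity), ← Real.exp_nat_mul]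
  have h2 : (2 * Real.pi)⁻¹ * (Real.pi / (1 / 2 - T)) = 1 / (1 - 2 * T) := by
    have : (1 - 2 * T) ≠ 0 := by linarith
    have := Real.pi_ne_zero
    field_simp
  rw [h2, div_le_iff₀ (by linarith), mul_comm]
  have := one_le_one_sub_mul_exp h0 h1
  rwa [show ((2 : ℕ) : ℝ) * (2 * T) = 4 * T by push_cast; ring]

variable {d : ℕ}

lemma stdGaussian_map_inner {u : EuclideanSpace ℝ (Fin d)} (hu : ‖u‖ = 1) :
    (stdGaussian (EuclideanSpace ℝ (Fin d))).map (fun x => inner ℝ x u) = gaussianReal 0 1 := by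
  have h : (fun x : EuclideanSpace ℝ (Fin d) => inner ℝ x u) = (innerSL ℝ u) := by
    ext x
    simp [real_inner_comm]
  rw [h, IsGaussian.map_eq_gaussianReal, integral_strongDual_stdGaussian,
    variance_dual_stdGaussian, innerSL_apply_norm, hu]
  simp

lemma lintegral_exp_sq_inner_stdGaussian {u : EuclideanSpace ℝ (Fin d)} (hu : ‖u‖ = 1)
    {T : ℝ} (h0 : 0 ≤ T) (h1 : T ≤ 1 / 4) :
    ∫⁻ x, ENNReal.ofReal (Real.exp (T * inner ℝ x u ^ 2))
      ∂(stdGaussian (EuclideanSpace ℝ (Fin d))) ≤ ENNReal.ofReal (Real.exp (2 * T)) := by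
  refine le_trans (le_of_eq ?_) (lintegral_exp_sq_gaussianReal h0 h1)
  rw [← stdGaussian_map_inner hu, lintegral_map (by fun_prop) (by fun_prop)]

/-- The three projections may be dependent, so the exponentials are separated by the inequality of
arithmetic and geometric means, at the price of a factor `3` in the exponent. -/
lemma lintegral_exp_sq_inner_three {u₁ u₂ u₃ : EuclideanSpace ℝ (Fin d)} (hu₁ : ‖u₁‖ = 1)
    (hu₂ : ‖u₂‖ = 1) (hu₃ : ‖u₃‖ = 1) {T : ℝ} (h0 : 0 ≤ T) (h1 : 3 * T ≤ 1 / 4) :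
    ∫⁻ x, ENNReal.ofReal (Real.exp (T * (inner ℝ x u₁ ^ 2 + inner ℝ x u₂ ^ 2 + inner ℝ x u₃ ^ 2)))
      ∂(stdGaussian (EuclideanSpace ℝ (Fin d))) ≤ ENNReal.ofReal (Real.exp (6 * T)) := by
  have h3 : (0 : ℝ) ≤ 3 * T := by linarith
  have key : ∀ x : EuclideanSpace ℝ (Fin d),
      ENNReal.ofReal (Real.exp (T * (inner ℝ x u₁ ^ 2 + inner ℝ x u₂ ^ 2 + inner ℝ x u₃ ^ 2))) ≤
      ENNReal.ofReal (1 / 3) * (ENNReal.ofReal (Real.exp (3 * T * inner ℝ x u₁ ^ 2)) +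
        ENNReal.ofReal (Real.exp (3 * T * inner ℝ x u₂ ^ 2)) +
        ENNReal.ofReal (Real.exp (3 * T * inner ℝ x u₃ ^ 2))) := by
    intro x
    rw [← ENNReal.ofReal_add (by positivity) (by positivity),
      ← ENNReal.ofReal_add (by positivity) (by positivity), ← ENNReal.ofReal_mul (by norm_num)]
    apply ENNReal.ofReal_le_ofReal
    rw [mul_add, mul_add, Real.exp_add, Real.exp_add, mul_assoc 3 T, mul_assoc 3 T, mul_assoc 3 T]
    have hcube : ∀ y : ℝ, Real.exp (3 * y) = Real.exp y ^ 3 := fun y => by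
      rw [← Real.exp_nat_mul]; norm_num
    simp only [hcube]
    have amgm : ∀ a b c : ℝ, 0 < a → 0 < b → 0 < c →
        a * b * c ≤ 1 / 3 * (a ^ 3 + b ^ 3 + c ^ 3) := fun a b c ha hb hc => by
      nlinarith [mul_nonneg (add_pos (add_pos ha hb) hc).le
        (add_nonneg (add_nonneg (sq_nonneg (a - b)) (sq_nonneg (b - c))) (sq_nonneg (a - c)))]
    exact amgm _ _ _ (Real.exp_pos _) (Real.exp_pos _) (Real.exp_pos _)
  refine (lintegral_mono key).trans ?_
  rw [lintegral_const_mul _ (by fun_prop), lintegral_add_left (by fun_prop),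
    lintegral_add_left (by fun_prop)]
  refine (mul_le_mul_right (add_le_add (add_le_add (lintegral_exp_sq_inner_stdGaussian hu₁ h3 h1)
    (lintegral_exp_sq_inner_stdGaussian hu₂ h3 h1))
    (lintegral_exp_sq_inner_stdGaussian hu₃ h3 h1)) _).trans ?_
  rw [← ENNReal.ofReal_add (by positivity) (by positivity),
      ← ENNReal.ofReal_add (by positivity) (by positivity), ← ENNReal.ofReal_mul (by norm_num)]
  apply ENNReal.ofReal_le_ofReal
  rw [show 2 * (3 * T) = 6 * T by ring]
  linarith

end GaussianMoments

/-! ### Density of one sample -/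

section SampleLaw

variable {d : ℕ}

instance sampleLaw.isProbabilityMeasure (θ : EuclideanSpace ℝ (Fin d)) :
    IsProbabilityMeasure (sampleLaw θ) := by
  unfold sampleLaw
  exact Measure.isProbabilityMeasure_map (by fun_prop)

lemma sampleLaw_zero : sampleLaw (0 : EuclideanSpace ℝ (Fin d)) =
    (stdGaussian (EuclideanSpace ℝ (Fin d))).prod (gaussianReal 0 1) := by
  simp [sampleLaw]

/-- The density of `sampleLaw θ` with respect to `sampleLaw 0`. -/
noncomputable def sampleDensity (θ : EuclideanSpace ℝ (Fin d))
    (z : EuclideanSpace ℝ (Fin d) × ℝ) : ℝ :=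
  Real.exp (inner ℝ z.1 θ * z.2 - inner ℝ z.1 θ ^ 2 / 2)

@[fun_prop]
lemma measurable_sampleDensity (θ : EuclideanSpace ℝ (Fin d)) : Measurable (sampleDensity θ) := by
  unfold sampleDensity
  fun_prop

lemma sampleDensity_pos (θ : EuclideanSpace ℝ (Fin d)) (z) : 0 < sampleDensity θ z :=
  Real.exp_pos _

/-- One-dimensional Cameron–Martin formula. -/
lemma lintegral_gaussianReal_shift (c : ℝ) {f : ℝ → ℝ≥0∞} (hf : Measurable f) :
    ∫⁻ z, f (c + z) ∂(gaussianReal 0 1) =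
      ∫⁻ z, ENNReal.ofReal (Real.exp (c * z - c ^ 2 / 2)) * f z ∂(gaussianReal 0 1) := by
  rw [← lintegral_map (g := fun z => c + z) hf (by fun_prop), gaussianReal_map_const_add]
  rw [gaussianReal_of_var_ne_zero _ one_ne_zero, gaussianReal_of_var_ne_zero _ one_ne_zero,
    lintegral_withDensity_eq_lintegral_mul _ (measurable_gaussianPDF _ 1) hf,
    lintegral_withDensity_eq_lintegral_mul _ (measurable_gaussianPDF _ 1) (by fun_prop)]
  refine lintegral_congr fun z => ?_
  simp only [Pi.mul_apply, gaussianPDF]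
  rw [← mul_assoc, ← ENNReal.ofReal_mul (gaussianPDFReal_nonneg 0 1 _)]
  congr 2
  simp only [gaussianPDFReal, NNReal.coe_one, mul_one, sub_zero]
  rw [mul_assoc _ (Real.exp _), ← Real.exp_add]
  congr 2
  ring

lemma sampleLaw_eq_withDensity (θ : EuclideanSpace ℝ (Fin d)) :
    sampleLaw θ = (sampleLaw 0).withDensity (fun z => ENNReal.ofReal (sampleDensity θ z)) := by
  refine Measure.ext_of_lintegral _ fun f hf => ?_
  rw [lintegral_withDensity_eq_lintegral_mul _ (by fun_prop) hf, sampleLaw_zero, sampleLaw,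
    lintegral_map hf (by fun_prop), lintegral_prod _ (by fun_prop), lintegral_prod _ (by fun_prop)]
  refine lintegral_congr fun x => ?_
  exact lintegral_gaussianReal_shift (inner ℝ x θ) (hf.comp (measurable_prodMk_left))

end SampleLaw

/-! ### Second-order estimates for `cosh` -/

section RealInequality

/-- The difference is `2 sinh((s+c)/2) sinh((s-c)/2)`, and `sinh x ≤ x exp x` for `x ≥ 0`. -/
lemma cosh_sub_cosh_le {s c : ℝ} (h : |c| ≤ s) :
    Real.cosh s - Real.cosh c ≤ (s ^ 2 - c ^ 2) / 2 * Real.exp s := by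
  have h1 := abs_le.1 h
  have key : ∀ x : ℝ, 0 ≤ x → Real.sinh x ≤ x * Real.exp x := fun x hx => by
    have h2 := Real.add_one_le_exp (-(2 * x))
    have h3 : Real.exp (-x) = Real.exp x * Real.exp (-(2 * x)) := by
      rw [← Real.exp_add]; congr 1; ring
    rw [Real.sinh_eq, h3]
    nlinarith [Real.exp_pos x]
  have hsub : Real.cosh s - Real.cosh c = 2 * (Real.sinh ((s + c) / 2) * Real.sinh ((s - c) / 2)) := by
    have e1 : s = (s + c) / 2 + (s - c) / 2 := by ring
    have e2 : c = (s + c) / 2 - (s - c) / 2 := by ring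
    conv_lhs => rw [e1, e2]
    rw [Real.cosh_add, Real.cosh_sub]
    ring_nf
  rw [hsub]
  have h4 := mul_le_mul (key ((s + c) / 2) (by linarith)) (key ((s - c) / 2) (by linarith))
    (Real.sinh_nonneg_iff.2 (by linarith)) (by have : 0 ≤ (s + c) / 2 := by linarith
                                               positivity)
  have h5 : (s + c) / 2 * Real.exp ((s + c) / 2) * ((s - c) / 2 * Real.exp ((s - c) / 2)) =
      (s ^ 2 - c ^ 2) / 4 * Real.exp s := by
    have : Real.exp s = Real.exp ((s + c) / 2) * Real.exp ((s - c) / 2) := by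
      rw [← Real.exp_add]; congr 1; ring
    rw [this]; ring
  linarith

/-- Here `A = |a|²`, `B = |b|²`, `C = ⟨a,b⟩` and `q = |a-b|²`. With `s`, `t` the half sum and half
difference of `A`, `B`, the bracket is `2 cosh s (cosh t - 1) + 2 (cosh s - cosh C)`. Both `t²` and
`s² - C²` are at most `q(A+B+2C)/4`. The factor `A + B` next to `q` is the gain from hiding the
sign. -/
lemma cosh_add_cosh_sub_le {A B C q : ℝ} (hA : 0 ≤ A) (hB : 0 ≤ B) (hq : q = A + B - 2 * C)
    (hq0 : 0 ≤ q) (hCS : (A - B) ^ 2 ≤ q * (A + B + 2 * C)) (hp : 0 ≤ A + B + 2 * C) :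
    Real.exp (B / 2) * (Real.cosh A + Real.cosh B - 2 * Real.cosh C) ≤
      q * (A + B) * Real.exp (3 / 2 * (A + B)) := by
  set s := (A + B) / 2 with hs
  set t := (A - B) / 2 with ht
  have hsum : Real.cosh A + Real.cosh B = 2 * Real.cosh s * Real.cosh t := by
    rw [show A = s + t by rw [hs, ht]; ring, show B = s - t by rw [hs, ht]; ring,
      Real.cosh_add, Real.cosh_sub]
    ring
  have hs0 : 0 ≤ s := by positivity
  have hC : |C| ≤ s := abs_le.2 ⟨by linarith, by linarith⟩
  have hts : |t| ≤ s := abs_le.2 ⟨by linarith, by linarith⟩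
  have h1 := cosh_sub_cosh_le hC
  have h2 : Real.cosh t - 1 ≤ t ^ 2 / 2 * Real.exp s := by
    have := cosh_sub_cosh_le (s := |t|) (c := 0) (by simp)
    rw [Real.cosh_abs, Real.cosh_zero, sq_abs] at this
    refine this.trans ?_
    have h3 := Real.exp_le_exp.2 hts
    have h4 : 0 ≤ t ^ 2 := sq_nonneg t
    nlinarith
  have hcosh : Real.cosh s ≤ Real.exp s := by
    rw [Real.cosh_eq]
    have := Real.exp_le_exp.2 (show -s ≤ s by linarith)
    linarith
  have h1e : 1 ≤ Real.exp s := Real.one_le_exp hs0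
  have hcs0 := Real.one_le_cosh t
  have hP : 0 ≤ q * (A + B + 2 * C) := mul_nonneg hq0 hp
  have hF : Real.cosh A + Real.cosh B - 2 * Real.cosh C ≤
      q * (A + B + 2 * C) / 2 * (Real.exp s * Real.exp s) := by
    have e1 : Real.cosh A + Real.cosh B - 2 * Real.cosh C =
        2 * Real.cosh s * (Real.cosh t - 1) + 2 * (Real.cosh s - Real.cosh C) := by
      rw [hsum]; ring
    have e2 : s ^ 2 - C ^ 2 = q * (A + B + 2 * C) / 4 := by rw [hs, hq]; ring
    have e3 : t ^ 2 ≤ q * (A + B + 2 * C) / 4 := by rw [ht]; linarith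
    rw [e2] at h1
    have h5 : 2 * Real.cosh s * (Real.cosh t - 1) ≤
        2 * Real.exp s * (q * (A + B + 2 * C) / 4 / 2 * Real.exp s) := by
      refine mul_le_mul (by linarith) (h2.trans ?_) (by linarith) (by positivity)
      gcongr
    rw [e1]
    have h6 : q * (A + B + 2 * C) * Real.exp s ≤ q * (A + B + 2 * C) * (Real.exp s * Real.exp s) :=
      mul_le_mul_of_nonneg_left (by nlinarith) hP
    linarith
  have hB2 : Real.exp (B / 2) ≤ Real.exp s := Real.exp_le_exp.2 (by linarith)
  have hfin : q * (A + B + 2 * C) / 2 ≤ q * (A + B) := by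
    have : A + B + 2 * C ≤ 2 * (A + B) := by linarith
    have := mul_le_mul_of_nonneg_left this hq0
    linarith
  have e3 : Real.exp (3 / 2 * (A + B)) = Real.exp s * (Real.exp s * Real.exp s) := by
    rw [← Real.exp_add, ← Real.exp_add]; congr 1; rw [hs]; ring
  rw [e3]
  calc _ ≤ Real.exp (B / 2) * (q * (A + B) * (Real.exp s * Real.exp s)) := by
        refine mul_le_mul_of_nonneg_left (hF.trans ?_) (Real.exp_pos _).le
        gcongr
    _ ≤ Real.exp s * (q * (A + B) * (Real.exp s * Real.exp s)) := by
        gcongr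
    _ = _ := by ring

end RealInequality

/-! ### Second moments of symmetric Gaussian mixtures -/

section GaussianCosh

variable {n : ℕ}

lemma integrable_exp_linear_pi (c : Fin n → ℝ) :
    Integrable (fun y : Fin n → ℝ => Real.exp (∑ l, c l * y l))
      (Measure.pi fun _ => gaussianReal 0 1) := by
  simp_rw [Real.exp_sum]
  exact Integrable.fintype_prod fun l => integrable_exp_mul_gaussianReal (c l)

lemma integral_exp_linear_pi (c : Fin n → ℝ) :
    ∫ y : Fin n → ℝ, Real.exp (∑ l, c l * y l) ∂(Measure.pi fun _ => gaussianReal 0 1) =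
      Real.exp ((∑ l, c l ^ 2) / 2) := by
  simp_rw [Real.exp_sum]
  rw [integral_fintype_prod_eq_prod (fun l y => Real.exp (c l * y)), Finset.sum_div, Real.exp_sum]
  refine Finset.prod_congr rfl fun l _ => ?_
  have := congrFun (mgf_id_gaussianReal (μ := 0) (v := 1)) (c l)
  simpa [mgf] using this

/-- The density of the symmetric mixture of `N(a, I)` and `N(-a, I)` with respect to `N(0, I)`. -/
noncomputable def mixDensity (a y : Fin n → ℝ) : ℝ :=
  Real.exp (-(∑ l, a l ^ 2) / 2) * Real.cosh (∑ l, a l * y l)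

lemma mixDensity_mul_eq (a b y : Fin n → ℝ) :
    mixDensity a y * mixDensity b y =
      Real.exp (-(∑ l, a l ^ 2) / 2) * Real.exp (-(∑ l, b l ^ 2) / 2) / 4 *
      (Real.exp (∑ l, (a + b) l * y l) + Real.exp (∑ l, (a - b) l * y l) +
        Real.exp (∑ l, (b - a) l * y l) + Real.exp (∑ l, (-a - b) l * y l)) := by
  simp only [mixDensity, Real.cosh_eq, Pi.add_apply, Pi.sub_apply, Pi.neg_apply, add_mul, sub_mul,
    neg_mul, Finset.sum_add_distrib, Finset.sum_sub_distrib, Finset.sum_neg_distrib,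
    Real.exp_add, Real.exp_sub, Real.exp_neg]
  have := (Real.exp_pos (∑ l, a l * y l)).ne'
  have := (Real.exp_pos (∑ l, b l * y l)).ne'
  field_simp
  ring

lemma integrable_mixDensity_mul (a b : Fin n → ℝ) :
    Integrable (fun y => mixDensity a y * mixDensity b y)
      (Measure.pi fun _ => gaussianReal 0 1) := by
  simp_rw [mixDensity_mul_eq]
  exact ((((integrable_exp_linear_pi _).add (integrable_exp_linear_pi _)).add
    (integrable_exp_linear_pi _)).add (integrable_exp_linear_pi _)).const_mul _

/-- For two fixed signs the Gaussian moment generating function gives `exp (±⟨a,b⟩)`; averaging over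
the signs leaves the hyperbolic cosine. -/
lemma integral_mixDensity_mul (a b : Fin n → ℝ) :
    ∫ y, mixDensity a y * mixDensity b y ∂(Measure.pi fun _ => gaussianReal 0 1) =
      Real.cosh (∑ l, a l * b l) := by
  simp_rw [mixDensity_mul_eq]
  have h2 : ∀ c c' : Fin n → ℝ, Integrable (fun y : Fin n → ℝ =>
      Real.exp (∑ l, c l * y l) + Real.exp (∑ l, c' l * y l))
      (Measure.pi fun _ => gaussianReal 0 1) := fun c c' =>
    (integrable_exp_linear_pi c).add (integrable_exp_linear_pi c')
  have h3 : ∀ c c' c'' : Fin n → ℝ, Integrable (fun y : Fin n → ℝ =>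
      Real.exp (∑ l, c l * y l) + Real.exp (∑ l, c' l * y l) + Real.exp (∑ l, c'' l * y l))
      (Measure.pi fun _ => gaussianReal 0 1) := fun c c' c'' =>
    (h2 c c').add (integrable_exp_linear_pi c'')
  rw [integral_const_mul, integral_add (h3 _ _ _) (integrable_exp_linear_pi _),
    integral_add (h2 _ _) (integrable_exp_linear_pi _),
    integral_add (integrable_exp_linear_pi _) (integrable_exp_linear_pi _)]
  simp only [integral_exp_linear_pi]
  have e : ∀ s t : ℝ, ∑ l, (s * a l + t * b l) ^ 2 =
      s ^ 2 * ∑ l, a l ^ 2 + 2 * s * t * ∑ l, a l * b l + t ^ 2 * ∑ l, b l ^ 2 := fun s t => by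
    simp only [Finset.mul_sum, ← Finset.sum_add_distrib]
    exact Finset.sum_congr rfl fun l _ => by ring
  set A := ∑ l, a l ^ 2 with hA
  set B := ∑ l, b l ^ 2 with hB
  set C := ∑ l, a l * b l with hC
  have e1 : ∑ l, (a + b) l ^ 2 = A + 2 * C + B := by
    rw [show A + 2 * C + B = 1 ^ 2 * A + 2 * 1 * 1 * C + 1 ^ 2 * B by ring, ← e]
    simp
  have e2 : ∑ l, (a - b) l ^ 2 = A - 2 * C + B := by
    rw [show A - 2 * C + B = 1 ^ 2 * A + 2 * 1 * (-1) * C + (-1) ^ 2 * B by ring, ← e]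
    simp [← sub_eq_add_neg]
  have e3 : ∑ l, (b - a) l ^ 2 = A - 2 * C + B := by
    rw [show A - 2 * C + B = (-1) ^ 2 * A + 2 * (-1) * 1 * C + 1 ^ 2 * B by ring, ← e]
    simp [add_comm, ← sub_eq_add_neg]
  have e4 : ∑ l, (-a - b) l ^ 2 = A + 2 * C + B := by
    rw [show A + 2 * C + B = (-1) ^ 2 * A + 2 * (-1) * (-1) * C + (-1) ^ 2 * B by ring, ← e]
    simp [← sub_eq_add_neg]
  rw [e1, e2, e3, e4, Real.cosh_eq, div_mul_eq_mul_div, div_eq_div_iff (by norm_num) (by norm_num)]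
  simp only [mul_add, ← Real.exp_add]
  ring_nf

lemma lintegral_sq_mixDensity_sub (a b : Fin n → ℝ) :
    ∫⁻ y, ENNReal.ofReal ((mixDensity a y - mixDensity b y) ^ 2)
      ∂(Measure.pi fun _ => gaussianReal 0 1) =
      ENNReal.ofReal (Real.cosh (∑ l, a l ^ 2) + Real.cosh (∑ l, b l ^ 2) -
        2 * Real.cosh (∑ l, a l * b l)) := by
  have e : ∀ y, (mixDensity a y - mixDensity b y) ^ 2 = mixDensity a y * mixDensity a y +
      mixDensity b y * mixDensity b y - 2 * (mixDensity a y * mixDensity b y) := fun y => by ring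
  have hi : Integrable (fun y => (mixDensity a y - mixDensity b y) ^ 2)
      (Measure.pi fun _ => gaussianReal 0 1) := by
    simp_rw [e]
    exact ((integrable_mixDensity_mul a a).add (integrable_mixDensity_mul b b)).sub
      ((integrable_mixDensity_mul a b).const_mul 2)
  rw [← ofReal_integral_eq_lintegral_ofReal hi (ae_of_all _ fun y => sq_nonneg _)]
  simp_rw [e]
  have h2 : Integrable (fun y => mixDensity a y * mixDensity a y + mixDensity b y * mixDensity b y)
      (Measure.pi fun _ => gaussianReal 0 1) :=
    (integrable_mixDensity_mul a a).add (integrable_mixDensity_mul b b)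
  rw [integral_sub h2
      ((integrable_mixDensity_mul a b).const_mul 2),
    integral_add (integrable_mixDensity_mul a a) (integrable_mixDensity_mul b b),
    integral_const_mul]
  simp only [integral_mixDensity_mul]
  simp only [← sq]

/-- The hypothesis `hCS` of `cosh_add_cosh_sub_le` is the Cauchy–Schwarz inequality for `a - b` and
`a + b`. -/
lemma exp_mul_cosh_le (a b : Fin n → ℝ) :
    Real.exp ((∑ l, b l ^ 2) / 2) * (Real.cosh (∑ l, a l ^ 2) + Real.cosh (∑ l, b l ^ 2) -
        2 * Real.cosh (∑ l, a l * b l)) ≤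
      (∑ l, (a l - b l) ^ 2) * (∑ l, a l ^ 2 + ∑ l, b l ^ 2) *
        Real.exp (3 / 2 * (∑ l, a l ^ 2 + ∑ l, b l ^ 2)) := by
  have hq : ∑ l, (a l - b l) ^ 2 = ∑ l, a l ^ 2 + ∑ l, b l ^ 2 - 2 * ∑ l, a l * b l := by
    simp only [Finset.mul_sum, ← Finset.sum_add_distrib, ← Finset.sum_sub_distrib]
    exact Finset.sum_congr rfl fun l _ => by ring
  have hp : ∑ l, (a l + b l) ^ 2 = ∑ l, a l ^ 2 + ∑ l, b l ^ 2 + 2 * ∑ l, a l * b l := by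
    simp only [Finset.mul_sum, ← Finset.sum_add_distrib]
    exact Finset.sum_congr rfl fun l _ => by ring
  refine cosh_add_cosh_sub_le (Finset.sum_nonneg fun _ _ => sq_nonneg _)
    (Finset.sum_nonneg fun _ _ => sq_nonneg _) hq (Finset.sum_nonneg fun _ _ => sq_nonneg _) ?_ ?_
  · rw [← hp]
    refine le_trans (le_of_eq ?_) (Finset.sum_mul_sq_le_sq_mul_sq _ _ _)
    congr 1
    rw [← Finset.sum_sub_distrib]
    exact Finset.sum_congr rfl fun l _ => by ring
  · rw [← hp]
    exact Finset.sum_nonneg fun _ _ => sq_nonneg _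

end GaussianCosh

/-! ### Chi-square bounds from densities over a common measure -/

section DensityQuotient

variable {Ω : Type*} [MeasurableSpace Ω]

lemma SqDensityLE.of_density {ν P Q : Measure Ω} {f g : Ω → ℝ} (hf : Measurable f)
    (hg : Measurable g) (hf0 : ∀ x, 0 ≤ f x) (hg0 : ∀ x, 0 < g x)
    (hP : P = ν.withDensity fun x => ENNReal.ofReal (f x))
    (hQ : Q = ν.withDensity fun x => ENNReal.ofReal (g x)) {κ : ℝ≥0∞}
    (h : ∫⁻ x, ENNReal.ofReal (f x ^ 2 / g x) ∂ν ≤ κ) : SqDensityLE P Q κ := by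
  refine ⟨fun x => ENNReal.ofReal (f x / g x), by fun_prop, ?_, ?_⟩
  · rw [hP, hQ, ← withDensity_mul _ (by fun_prop) (by fun_prop)]
    congr 1
    ext x
    rw [Pi.mul_apply, ← ENNReal.ofReal_mul (hg0 x).le, mul_div_cancel₀ _ (hg0 x).ne']
  · rw [hQ, lintegral_withDensity_eq_lintegral_mul _ (by fun_prop) (by fun_prop)]
    refine le_trans (le_of_eq (lintegral_congr fun x => ?_)) h
    have := hg0 x
    rw [Pi.mul_apply, ← ENNReal.ofReal_pow (div_nonneg (hf0 x) this.le),
      ← ENNReal.ofReal_mul this.le]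
    congr 1
    field_simp

/-- Integrate `f²/g + g = (f - g)²/g + 2f`, where `f` and `g` have mass one. -/
lemma SqDensityLE.of_density_sub {ν P Q : Measure Ω} [IsProbabilityMeasure P]
    [IsProbabilityMeasure Q] {f g : Ω → ℝ} (hf : Measurable f)
    (hg : Measurable g) (hf0 : ∀ x, 0 ≤ f x) (hg0 : ∀ x, 0 < g x)
    (hP : P = ν.withDensity fun x => ENNReal.ofReal (f x))
    (hQ : Q = ν.withDensity fun x => ENNReal.ofReal (g x)) {κ : ℝ≥0∞}
    (h : ∫⁻ x, ENNReal.ofReal ((f x - g x) ^ 2 / g x) ∂ν ≤ κ) : SqDensityLE P Q (1 + κ) := by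
  refine SqDensityLE.of_density hf hg hf0 hg0 hP hQ ?_
  have hone : ∀ (P : Measure Ω) [IsProbabilityMeasure P] (f : Ω → ℝ),
      (P = ν.withDensity fun x => ENNReal.ofReal (f x)) → ∫⁻ x, ENNReal.ofReal (f x) ∂ν = 1 := by
    intro P _ f h
    have := measure_univ (μ := P)
    rwa [h, withDensity_apply _ MeasurableSet.univ, setLIntegral_univ] at this
  have key : ∀ x, ENNReal.ofReal (f x ^ 2 / g x) + ENNReal.ofReal (g x) =
      ENNReal.ofReal ((f x - g x) ^ 2 / g x) + 2 * ENNReal.ofReal (f x) := by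
    intro x
    have h0 := hf0 x
    have h1 := hg0 x
    rw [show (2 : ℝ≥0∞) = ENNReal.ofReal 2 by simp, ← ENNReal.ofReal_mul (by norm_num),
      ← ENNReal.ofReal_add (by positivity) (by positivity),
      ← ENNReal.ofReal_add (by positivity) (by positivity)]
    congr 1
    field_simp
    ring
  have h1 := lintegral_congr (μ := ν) key
  rw [lintegral_add_left (by fun_prop), lintegral_add_left (by fun_prop),
    lintegral_const_mul _ (by fun_prop), hone P f hP, hone Q g hQ] at h1
  have h2 : ∫⁻ x, ENNReal.ofReal (f x ^ 2 / g x) ∂ν + 1 ≤ (1 + κ) + 1 := by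
    rw [h1, mul_one, show (1 + κ) + 1 = κ + 2 by rw [← one_add_one_eq_two]; ring]
    gcongr
  exact (ENNReal.add_le_add_iff_right (by simp)).1 h2

end DensityQuotient

/-! ### Divergence of one sample with known sign -/

section KnownSign

variable {d : ℕ}

/-- Given the covariate `x`, the second moment of the density of `N(a,1)` over `N(b,1)` is `exp
((a-b)²)` with `a - b = t⟨x,f⟩`; it remains to average over `x`. -/
lemma SqDensityLE.sampleLaw {θ φ f : EuclideanSpace ℝ (Fin d)} {t : ℝ} (hf : ‖f‖ = 1)
    (h : θ - φ = t • f) (ht : t ^ 2 ≤ 1 / 4) :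
    SqDensityLE (sampleLaw θ) (sampleLaw φ) (ENNReal.ofReal (Real.exp (2 * t ^ 2))) := by
  refine SqDensityLE.of_density (measurable_sampleDensity θ) (measurable_sampleDensity φ)
    (fun z => (sampleDensity_pos θ z).le) (sampleDensity_pos φ)
    (sampleLaw_eq_withDensity θ) (sampleLaw_eq_withDensity φ) ?_
  refine le_trans ?_ (lintegral_exp_sq_inner_stdGaussian hf (sq_nonneg t) ht)
  rw [sampleLaw_zero, lintegral_prod _ (by fun_prop)]
  refine lintegral_mono fun x => le_of_eq ?_
  set a := inner ℝ x θ with ha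
  set b := inner ℝ x φ with hb
  have hab : t * inner ℝ x f = a - b := by
    rw [ha, hb, ← inner_sub_right, h, inner_smul_right]
  -- Completing the square: what remains besides `exp ((a-b)²)` is the density of a shift by `2a -
  -- b`, which has mass one.
  have key : ∀ y : ℝ, ENNReal.ofReal (sampleDensity θ (x, y) ^ 2 / sampleDensity φ (x, y)) =
      ENNReal.ofReal (Real.exp (t ^ 2 * inner ℝ x f ^ 2)) *
        (ENNReal.ofReal (Real.exp ((2 * a - b) * y - (2 * a - b) ^ 2 / 2)) * 1) := by
    intro y
    rw [mul_one, ← ENNReal.ofReal_mul (Real.exp_pos _).le, ← mul_pow, hab]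
    simp only [sampleDensity, ← ha, ← hb]
    rw [← Real.exp_nat_mul, ← Real.exp_sub, ← Real.exp_add]
    congr 2
    push_cast
    ring
  simp_rw [key]
  rw [lintegral_const_mul _ (by fun_prop),
    ← lintegral_gaussianReal_shift (2 * a - b) (measurable_const (a := (1 : ℝ≥0∞)))]
  simp

end KnownSign

/-! ### Divergence of one client with random sign -/

section UnknownSign

variable {d : ℕ}

/-- `n` samples of a client whose parameter is `θ` or `-θ` with probability one half each. -/
noncomputable def signMix (n : ℕ) (θ : EuclideanSpace ℝ (Fin d)) :
    Measure (Fin n → EuclideanSpace ℝ (Fin d) × ℝ) :=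
  halfMix fun b => Measure.pi fun _ : Fin n => sampleLaw (if b then θ else -θ)

instance signMix.isProbabilityMeasure (n : ℕ) (θ : EuclideanSpace ℝ (Fin d)) :
    IsProbabilityMeasure (signMix n θ) := by
  unfold signMix; infer_instance

/-- The density of `signMix n θ` with respect to the law of `n` samples with parameter `0`. -/
noncomputable def signMixDensity {n : ℕ} (θ : EuclideanSpace ℝ (Fin d))
    (z : Fin n → EuclideanSpace ℝ (Fin d) × ℝ) : ℝ :=
  mixDensity (fun l => inner ℝ (z l).1 θ) (fun l => (z l).2)

lemma Measurable.mixDensity {Ω : Type*} [MeasurableSpace Ω] {n : ℕ} {f g : Ω → Fin n → ℝ}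
    (hf : ∀ l, Measurable fun x => f x l) (hg : ∀ l, Measurable fun x => g x l) :
    Measurable fun x => mixDensity (f x) (g x) := by
  refine Measurable.mul ?_ (Real.measurable_cosh.comp ?_)
  · exact Real.measurable_exp.comp (((Finset.measurable_sum _ fun l _ =>
      (hf l).pow_const 2).neg).div_const 2)
  · exact Finset.measurable_sum _ fun l _ => (hf l).mul (hg l)

lemma measurable_signMixDensity {n : ℕ} (θ : EuclideanSpace ℝ (Fin d)) :
    Measurable (signMixDensity (n := n) θ) :=
  Measurable.mixDensity (fun l => by fun_prop) (fun l => by fun_prop)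

lemma exp_neg_le_mixDensity {n : ℕ} (a y : Fin n → ℝ) :
    Real.exp (-(∑ l, a l ^ 2) / 2) ≤ mixDensity a y :=
  le_mul_of_one_le_right (Real.exp_pos _).le (Real.one_le_cosh _)

lemma mixDensity_pos {n : ℕ} (a y : Fin n → ℝ) : 0 < mixDensity a y :=
  (Real.exp_pos _).trans_le (exp_neg_le_mixDensity a y)

lemma pi_sampleLaw_eq_withDensity (n : ℕ) (θ : EuclideanSpace ℝ (Fin d)) :
    (Measure.pi fun _ : Fin n => sampleLaw θ) =
      (Measure.pi fun _ : Fin n => sampleLaw (0 : EuclideanSpace ℝ (Fin d))).withDensity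
        fun z => ENNReal.ofReal (∏ l, sampleDensity θ (z l)) := by
  have h := sampleLaw_eq_withDensity θ
  have : IsProbabilityMeasure ((sampleLaw (0 : EuclideanSpace ℝ (Fin d))).withDensity
      fun z => ENNReal.ofReal (sampleDensity θ z)) := by rw [← h]; infer_instance
  rw [h, pi_withDensity _ (fun _ : Fin n => fun z => ENNReal.ofReal (sampleDensity θ z))
    (fun _ => by fun_prop)]
  congr 1
  ext z
  rw [ENNReal.ofReal_prod_of_nonneg fun l _ => (sampleDensity_pos θ _).le]

lemma signMixDensity_eq {n : ℕ} (θ : EuclideanSpace ℝ (Fin d))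
    (z : Fin n → EuclideanSpace ℝ (Fin d) × ℝ) :
    signMixDensity θ z =
      2⁻¹ * (∏ l, sampleDensity θ (z l) + ∏ l, sampleDensity (-θ) (z l)) := by
  simp only [signMixDensity, mixDensity, sampleDensity, inner_neg_right, neg_sq, ← Real.exp_sum,
    neg_mul]
  rw [Finset.sum_sub_distrib, Finset.sum_sub_distrib, Finset.sum_neg_distrib, ← Finset.sum_div,
    sub_eq_add_neg, sub_eq_add_neg, Real.exp_add, Real.exp_add, Real.cosh_eq, ← neg_div]
  ring

lemma signMix_eq_withDensity (n : ℕ) (θ : EuclideanSpace ℝ (Fin d)) :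
    signMix n θ =
      (Measure.pi fun _ : Fin n => sampleLaw (0 : EuclideanSpace ℝ (Fin d))).withDensity
        fun z => ENNReal.ofReal (signMixDensity θ z) := by
  have h : (fun z : Fin n → EuclideanSpace ℝ (Fin d) × ℝ => ENNReal.ofReal (signMixDensity θ z)) =
      (2⁻¹ : ℝ≥0∞) • ((fun z => ENNReal.ofReal (∏ l, sampleDensity θ (z l))) +
        fun z => ENNReal.ofReal (∏ l, sampleDensity (-θ) (z l))) := by
    ext z
    have h1 : 0 ≤ ∏ l, sampleDensity θ (z l) :=
      Finset.prod_nonneg fun l _ => (sampleDensity_pos θ _).le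
    have h2 : 0 ≤ ∏ l, sampleDensity (-θ) (z l) :=
      Finset.prod_nonneg fun l _ => (sampleDensity_pos (-θ) _).le
    rw [signMixDensity_eq, ENNReal.ofReal_mul (by norm_num), ENNReal.ofReal_add h1 h2,
      ENNReal.ofReal_inv_of_pos (by norm_num)]
    simp
  rw [h, withDensity_smul _ (by fun_prop), withDensity_add_left (by fun_prop)]
  simp only [signMix, halfMix, if_true, Bool.false_eq_true, if_false]
  rw [pi_sampleLaw_eq_withDensity n θ, pi_sampleLaw_eq_withDensity n (-θ)]

lemma lintegral_pi_sampleLaw_zero {n : ℕ}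
    {F : (Fin n → EuclideanSpace ℝ (Fin d)) × (Fin n → ℝ) → ℝ≥0∞} (hF : Measurable F) :
    ∫⁻ z, F (fun l => (z l).1, fun l => (z l).2)
        ∂(Measure.pi fun _ : Fin n => sampleLaw (0 : EuclideanSpace ℝ (Fin d))) =
      ∫⁻ x, ∫⁻ y, F (x, y) ∂(Measure.pi fun _ => gaussianReal 0 1)
        ∂(Measure.pi fun _ => stdGaussian (EuclideanSpace ℝ (Fin d))) := by
  rw [← lintegral_prod _ hF.aemeasurable, sampleLaw_zero]
  exact (measurePreserving_arrowProdEquivProdArrow (EuclideanSpace ℝ (Fin d)) ℝ (Fin n)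
    (fun _ => stdGaussian (EuclideanSpace ℝ (Fin d))) (fun _ => gaussianReal 0 1)).lintegral_comp hF

/-- Given the covariates, the denominator is at least `exp (-|b|²/2)` because `cosh ≥ 1`. The
numerator then becomes a plain second moment over the responses, which is known in closed form. -/
lemma lintegral_signMixDensity_sub_le (n : ℕ) (θ φ : EuclideanSpace ℝ (Fin d)) :
    ∫⁻ z, ENNReal.ofReal ((signMixDensity θ z - signMixDensity φ z) ^ 2 / signMixDensity φ z)
        ∂(Measure.pi fun _ : Fin n => sampleLaw (0 : EuclideanSpace ℝ (Fin d))) ≤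
      ∫⁻ x : Fin n → EuclideanSpace ℝ (Fin d),
        ENNReal.ofReal ((∑ l, inner ℝ (x l) (θ - φ) ^ 2) *
          (∑ l, inner ℝ (x l) θ ^ 2 + ∑ l, inner ℝ (x l) φ ^ 2) *
          Real.exp (3 / 2 * (∑ l, inner ℝ (x l) θ ^ 2 + ∑ l, inner ℝ (x l) φ ^ 2)))
        ∂(Measure.pi fun _ => stdGaussian (EuclideanSpace ℝ (Fin d))) := by
  have hm : ∀ ψ : EuclideanSpace ℝ (Fin d), Measurable
      fun p : (Fin n → EuclideanSpace ℝ (Fin d)) × (Fin n → ℝ) =>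
        mixDensity (fun l => inner ℝ (p.1 l) ψ) p.2 := by
    intro ψ
    exact Measurable.mixDensity (fun l => by fun_prop) (fun l => by fun_prop)
  refine le_trans (le_of_eq (lintegral_pi_sampleLaw_zero
    (F := fun p => ENNReal.ofReal ((mixDensity (fun l => inner ℝ (p.1 l) θ) p.2 -
      mixDensity (fun l => inner ℝ (p.1 l) φ) p.2) ^ 2 /
        mixDensity (fun l => inner ℝ (p.1 l) φ) p.2))
    ((((hm θ).sub (hm φ)).pow_const 2).div (hm φ)).ennreal_ofReal)) ?_
  refine lintegral_mono fun x => ?_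
  set a : Fin n → ℝ := fun l => inner ℝ (x l) θ with ha
  set b : Fin n → ℝ := fun l => inner ℝ (x l) φ with hb
  have h1 : ∀ y, ENNReal.ofReal ((mixDensity a y - mixDensity b y) ^ 2 / mixDensity b y) ≤
      ENNReal.ofReal (Real.exp ((∑ l, b l ^ 2) / 2)) *
        ENNReal.ofReal ((mixDensity a y - mixDensity b y) ^ 2) := by
    intro y
    rw [← ENNReal.ofReal_mul (Real.exp_pos _).le]
    apply ENNReal.ofReal_le_ofReal
    rw [div_le_iff₀ (mixDensity_pos b y)]
    have h2 := exp_neg_le_mixDensity b y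
    have h3 : Real.exp ((∑ l, b l ^ 2) / 2) * Real.exp (-(∑ l, b l ^ 2) / 2) = 1 := by
      rw [← Real.exp_add, neg_div, add_neg_cancel, Real.exp_zero]
    have h4 : 1 ≤ Real.exp ((∑ l, b l ^ 2) / 2) * mixDensity b y := by
      rw [← h3]; gcongr
    nlinarith [sq_nonneg (mixDensity a y - mixDensity b y)]
  refine (lintegral_mono h1).trans ?_
  have hma : Measurable (mixDensity a) :=
    Measurable.mixDensity (fun l => measurable_const) (fun l => by fun_prop)
  have hmb : Measurable (mixDensity b) :=
    Measurable.mixDensity (fun l => measurable_const) (fun l => by fun_prop)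
  have hsub : Measurable fun y => ENNReal.ofReal ((mixDensity a y - mixDensity b y) ^ 2) :=
    ((hma.sub hmb).pow_const 2).ennreal_ofReal
  rw [lintegral_const_mul _ hsub, lintegral_sq_mixDensity_sub,
    ← ENNReal.ofReal_mul (Real.exp_pos _).le]
  apply ENNReal.ofReal_le_ofReal
  refine (exp_mul_cosh_le a b).trans (le_of_eq ?_)
  simp only [ha, hb, inner_sub_right]

lemma sq_le_exp {Z m : ℝ} (hm : 0 < m) (hZ : 0 ≤ Z) : Z ^ 2 ≤ m ^ 2 * Real.exp (2 / m * Z) := by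
  have h1 : Z ≤ m * Real.exp (Z / m) := by
    have := Real.add_one_le_exp (Z / m)
    have h2 : m * (Z / m) = Z := by field_simp
    nlinarith
  calc Z ^ 2 ≤ (m * Real.exp (Z / m)) ^ 2 := by gcongr
    _ = _ := by
      rw [mul_pow, ← Real.exp_nat_mul]
      congr 2
      push_cast
      field_simp

/-- With `V`, `V'`, `H` the sums over the samples of the squared projections on `v`, `v'`, `f`, the
conditional bound is `4w⁴η² H(V+V')` times an exponential. Each sum is typically of order `n`, hence
`n²w⁴η²`. The polynomial factor is absorbed into an exponential of rate of order `1/n`, whose moment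
over `n` samples stays bounded. -/
lemma SqDensityLE.signMix {n : ℕ} (hn : 1 ≤ n) {v v' f : EuclideanSpace ℝ (Fin d)} {w η : ℝ}
    (hv : ‖v‖ = 1) (hv' : ‖v'‖ = 1) (hf : ‖f‖ = 1) (h : v - v' = (2 * η) • f)
    (hw : w ^ 2 ≤ 1 / 36) :
    SqDensityLE (signMix n (w • v)) (signMix n (w • v'))
      (ENNReal.ofReal (1 + 2304 * Real.exp (1 / 4 + 9 * (n * w ^ 2)) *
        ((n : ℝ) ^ 2 * w ^ 4 * η ^ 2))) := by
  have hn0 : (0 : ℝ) < n := by exact_mod_cast hn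
  have hn1 : (1 : ℝ) ≤ n := by exact_mod_cast hn
  rw [ENNReal.ofReal_add zero_le_one (by positivity), ENNReal.ofReal_one]
  refine SqDensityLE.of_density_sub (measurable_signMixDensity _) (measurable_signMixDensity _)
    (fun z => (mixDensity_pos _ _).le) (fun z => mixDensity_pos _ _)
    (signMix_eq_withDensity n _) (signMix_eq_withDensity n _) ?_
  refine (lintegral_signMixDensity_sub_le n _ _).trans ?_
  -- The first term comes from `sq_le_exp` with `m = 48n`, the second from the exponential already
  -- present. With `n ≥ 1` and `w² ≤ 1/36` each is at most `1/24`, so `3T ≤ 1/4`. The constant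
  -- `2304` is `48²`.
  set T : ℝ := 2 / (48 * n) + 3 / 2 * w ^ 2 with hT
  have hT0 : 0 ≤ T := by positivity
  have hT1 : 3 * T ≤ 1 / 4 := by
    have : 2 / (48 * (n : ℝ)) ≤ 1 / 24 := by
      rw [div_le_div_iff₀ (by positivity) (by norm_num)]; linarith
    rw [hT]; linarith
  have key : ∀ x : Fin n → EuclideanSpace ℝ (Fin d),
      ENNReal.ofReal ((∑ l, inner ℝ (x l) (w • v - w • v') ^ 2) *
          (∑ l, inner ℝ (x l) (w • v) ^ 2 + ∑ l, inner ℝ (x l) (w • v') ^ 2) *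
          Real.exp (3 / 2 * (∑ l, inner ℝ (x l) (w • v) ^ 2 + ∑ l, inner ℝ (x l) (w • v') ^ 2))) ≤
        ENNReal.ofReal (2304 * ((n : ℝ) ^ 2 * w ^ 4 * η ^ 2)) *
        ∏ l, ENNReal.ofReal (Real.exp (T * (inner ℝ (x l) v ^ 2 + inner ℝ (x l) v' ^ 2 +
          inner ℝ (x l) f ^ 2))) := by
    intro x
    rw [← ENNReal.ofReal_prod_of_nonneg (fun l _ => (Real.exp_pos _).le),
      ← ENNReal.ofReal_mul (by positivity), ← Real.exp_sum, ← Finset.mul_sum]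
    apply ENNReal.ofReal_le_ofReal
    rw [← smul_sub, h]
    simp only [inner_smul_right, mul_pow, ← Finset.mul_sum, Finset.sum_add_distrib]
    set V := ∑ l, inner ℝ (x l) v ^ 2
    set V' := ∑ l, inner ℝ (x l) v' ^ 2
    set H := ∑ l, inner ℝ (x l) f ^ 2
    have hV : 0 ≤ V := Finset.sum_nonneg fun _ _ => sq_nonneg _
    have hV' : 0 ≤ V' := Finset.sum_nonneg fun _ _ => sq_nonneg _
    have hH : 0 ≤ H := Finset.sum_nonneg fun _ _ => sq_nonneg _
    have h1 := sq_le_exp (m := 48 * n) (by positivity) (show 0 ≤ V + V' + H by positivity)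
    have h2 : 4 * (H * (V + V')) ≤ (V + V' + H) ^ 2 := by nlinarith [sq_nonneg (V + V' - H)]
    have h3 : Real.exp (3 / 2 * (w ^ 2 * V + w ^ 2 * V')) ≤
        Real.exp (3 / 2 * w ^ 2 * (V + V' + H)) := by
      apply Real.exp_le_exp.2
      have : 0 ≤ w ^ 2 * H := by positivity
      linarith
    have h4 : Real.exp (T * (V + V' + H)) = Real.exp (2 / (48 * n) * (V + V' + H)) *
        Real.exp (3 / 2 * w ^ 2 * (V + V' + H)) := by
      rw [← Real.exp_add, ← add_mul]
    rw [h4]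
    have h5 : w ^ 2 * (2 ^ 2 * η ^ 2 * H) * (w ^ 2 * V + w ^ 2 * V') ≤
        w ^ 4 * η ^ 2 * ((48 * n) ^ 2 * Real.exp (2 / (48 * n) * (V + V' + H))) := by
      calc _ = w ^ 4 * η ^ 2 * (4 * (H * (V + V'))) := by ring
        _ ≤ _ := mul_le_mul_of_nonneg_left (h2.trans h1) (by positivity)
    calc _ ≤ w ^ 4 * η ^ 2 * ((48 * n) ^ 2 * Real.exp (2 / (48 * n) * (V + V' + H))) *
          Real.exp (3 / 2 * w ^ 2 * (V + V' + H)) := by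
            refine mul_le_mul (le_trans (le_of_eq (by ring)) h5) h3 (Real.exp_pos _).le (by positivity)
      _ = _ := by ring
  refine (lintegral_mono key).trans ?_
  rw [lintegral_const_mul _ (by fun_prop),
    lintegral_pi_prod _ (fun _ x => ENNReal.ofReal (Real.exp (T * (inner ℝ x v ^ 2 +
      inner ℝ x v' ^ 2 + inner ℝ x f ^ 2)))) (fun _ => by fun_prop)]
  have h6 := Finset.prod_le_prod' (s := (Finset.univ : Finset (Fin n)))
    (fun _ _ => lintegral_exp_sq_inner_three hv hv' hf hT0 hT1)
  refine (mul_le_mul_right h6 _).trans ?_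
  rw [Finset.prod_const, Finset.card_univ, Fintype.card_fin, ← ENNReal.ofReal_pow (Real.exp_pos _).le,
    ← ENNReal.ofReal_mul (by positivity), ← Real.exp_nat_mul]
  apply ENNReal.ofReal_le_ofReal
  have h7 : (n : ℝ) * (6 * T) = 1 / 4 + 9 * (n * w ^ 2) := by
    rw [hT]; field_simp; ring
  rw [h7]
  exact le_of_eq (by ring)

end UnknownSign

/-! ### The planted family and its separation -/

section Planted

variable {d k : ℕ}

/-- The first column of the planted matrix: `c` in coordinate `0` and signs `±η` in the
coordinates `i ≥ k`. -/
def plantedVec (k : ℕ) (c η : ℝ) (σ : Fin d → Bool) (i : Fin d) : ℝ :=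
  if i.val = 0 then c else if k ≤ i.val then (if σ i then η else -η) else 0

/-- The matrix with first column `plantedVec` whose other columns are coordinate vectors. -/
def plantedMatrix (k : ℕ) (c η : ℝ) (σ : Fin d → Bool) : Matrix (Fin d) (Fin k) ℝ :=
  fun i j => if j.val = 0 then plantedVec k c η σ i else if i.val = j.val then 1 else 0

/-- The coordinates that carry a hidden sign. -/
def signCoords (d k : ℕ) : Finset (Fin d) := Finset.univ.filter fun i => k ≤ i.val

lemma card_signCoords (hkd : k ≤ d) : (signCoords d k).card = d - k := by
  have h := Finset.card_filter_add_card_filter_not (s := (Finset.univ : Finset (Fin d)))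
    (fun i => i.val < k)
  rw [Fin.card_filter_val_lt, Finset.card_univ, Fintype.card_fin] at h
  simp only [not_lt] at h
  rw [signCoords]
  omega

lemma sum_sq_plantedVec (hk : 1 ≤ k) (hkd : k ≤ d) (c η : ℝ) (σ : Fin d → Bool) :
    ∑ i, plantedVec k c η σ i ^ 2 = c ^ 2 + ((d : ℝ) - k) * η ^ 2 := by
  have h : ∀ i : Fin d, plantedVec k c η σ i ^ 2 =
      (if i = ⟨0, by omega⟩ then c ^ 2 else 0) + (if k ≤ i.val then η ^ 2 else 0) := by
    intro i
    unfold plantedVec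
    by_cases h0 : i.val = 0
    · have : i = ⟨0, by omega⟩ := Fin.ext h0
      rw [if_pos h0, if_pos this, if_neg (by omega), add_zero]
    · have : i ≠ ⟨0, by omega⟩ := fun h => h0 (by rw [h])
      rw [if_neg h0, if_neg this, zero_add]
      split_ifs <;> simp
  simp_rw [h]
  rw [Finset.sum_add_distrib, Finset.sum_ite_eq' Finset.univ, if_pos (Finset.mem_univ _),
    ← Finset.sum_filter, Finset.sum_const, ← signCoords, card_signCoords hkd, nsmul_eq_mul,
    Nat.cast_sub hkd]

lemma plantedMatrix_orthonormal (hk : 1 ≤ k) (hkd : k ≤ d) {c η : ℝ}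
    (h : c ^ 2 + ((d : ℝ) - k) * η ^ 2 = 1) (σ : Fin d → Bool) :
    (plantedMatrix k c η σ).transpose * plantedMatrix k c η σ = 1 := by
  have hcol : ∀ (j : Fin k), j.val ≠ 0 → ∀ g : Fin d → ℝ,
      ∑ i, plantedMatrix k c η σ i j * g i = g (Fin.castLE hkd j) := by
    intro j hj g
    rw [Finset.sum_eq_single (Fin.castLE hkd j)]
    · simp [plantedMatrix, hj]
    · intro i _ hi
      have : i.val ≠ j.val := fun h => hi (Fin.ext h)
      simp [plantedMatrix, hj, this]
    · simp
  have hv : ∀ (j j' : Fin k), j.val ≠ 0 →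
      plantedMatrix k c η σ (Fin.castLE hkd j) j' = if j = j' then 1 else 0 := by
    intro j j' hj
    by_cases hj' : j'.val = 0
    · have : j ≠ j' := fun h => hj (by rw [h, hj'])
      simp [plantedMatrix, hj', plantedVec, hj, this]
    · simp [plantedMatrix, hj', Fin.ext_iff]
  ext j j'
  rw [Matrix.mul_apply, Matrix.one_apply]
  simp only [Matrix.transpose_apply]
  by_cases hj : j.val = 0
  · by_cases hj' : j'.val = 0
    · have : j = j' := Fin.ext (by omega)
      rw [if_pos this, ← h, ← sum_sq_plantedVec hk hkd c η σ]
      exact Finset.sum_congr rfl fun i _ => by simp [plantedMatrix, hj, hj', sq]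
    · rw [Finset.sum_congr rfl fun i _ => mul_comm _ _, hcol j' hj', hv j' j hj']
      simp [eq_comm]
  · rw [hcol j hj, hv j j' hj]

/-- The planted matrix as an element of `𝒪^{d×k}`. -/
def planted (hk : 1 ≤ k) (hkd : k ≤ d) {c η : ℝ} (h : c ^ 2 + ((d : ℝ) - k) * η ^ 2 = 1)
    (σ : Fin d → Bool) : OrthoMat d k :=
  ⟨plantedMatrix k c η σ, plantedMatrix_orthonormal hk hkd h σ⟩

/-- Row `0` of the planted matrix is supported on the first column, so this entry of the projection
exposes a single hidden sign. -/
lemma planted_mul_transpose_apply (hk : 1 ≤ k) (hkd : k ≤ d) {c η : ℝ}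
    (h : c ^ 2 + ((d : ℝ) - k) * η ^ 2 = 1) (σ : Fin d → Bool) {i : Fin d} (hi : k ≤ i.val) :
    ((planted hk hkd h σ).1 * (planted hk hkd h σ).1.transpose) i ⟨0, by omega⟩ =
      (if σ i then η else -η) * c := by
  have hi0 : i.val ≠ 0 := by omega
  rw [Matrix.mul_apply, Finset.sum_eq_single ⟨0, hk⟩]
  · simp [planted, plantedMatrix, plantedVec, hi0, hi]
  · intro j _ hj
    have : j.val ≠ 0 := fun h => hj (Fin.ext h)
    simp [planted, plantedMatrix, this, Ne.symm this]
  · simp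

/-- Estimating the hidden sign in coordinate `i` by the sign of an entry of the projection, these
are the matrices for which the estimate differs from `b`. -/
def wrongSign (hd : 0 < d) (i : Fin d) (b : Bool) : Set (OrthoMat d k) :=
  {B | ¬ (b = true ↔ 0 < (B.1 * B.1.transpose) i ⟨0, hd⟩)}

lemma wrongSign_not (hd : 0 < d) (i : Fin d) (b : Bool) :
    wrongSign (k := k) hd i (!b) = (wrongSign hd i b)ᶜ := by
  ext B
  cases b <;> simp [wrongSign]

lemma measurableSet_wrongSign (hd : 0 < d) (i : Fin d) (b : Bool) :
    MeasurableSet (wrongSign (k := k) hd i b) := by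
  have hent : ∀ (i : Fin d) (j : Fin k), Measurable fun B : OrthoMat d k => B.1 i j := by
    intro i j
    have h : Measurable fun (B : OrthoMat d k) (i : Fin d) (j : Fin k) => B.1 i j :=
      comap_measurable _
    exact (measurable_pi_apply j).comp ((measurable_pi_apply i).comp h)
  have hm : Measurable fun B : OrthoMat d k => (B.1 * B.1.transpose) i ⟨0, hd⟩ := by
    simp only [Matrix.mul_apply, Matrix.transpose_apply]
    exact Finset.measurable_sum _ fun j _ => (hent _ _).mul (hent _ _)
  have h0 : MeasurableSet {B : OrthoMat d k | 0 < (B.1 * B.1.transpose) i ⟨0, hd⟩} :=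
    measurableSet_lt measurable_const hm
  have ht : MeasurableSet (wrongSign (k := k) hd i true) := by
    have : wrongSign (k := k) hd i true = {B | 0 < (B.1 * B.1.transpose) i ⟨0, hd⟩}ᶜ := by
      ext B; simp [wrongSign]
    rw [this]; exact h0.compl
  cases b
  · have := wrongSign_not (k := k) hd i true
    rw [Bool.not_true] at this
    rw [this]; exact ht.compl
  · exact ht

/-- The column is the image of a unit vector, so its Euclidean norm is at most the operator norm;
Cauchy–Schwarz on `S` does the rest. -/
lemma sum_abs_col_le_opNorm (A : Matrix (Fin d) (Fin d) ℝ) (j : Fin d) (S : Finset (Fin d)) :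
    ∑ i ∈ S, |A i j| ≤ √(S.card) * ‖Matrix.toEuclideanCLM (𝕜 := ℝ) A‖ := by
  have h1 := (Matrix.toEuclideanCLM (𝕜 := ℝ) A).le_opNorm (EuclideanSpace.single j 1)
  rw [PiLp.norm_single, norm_one, mul_one] at h1
  have h2 : ∀ i, Matrix.toEuclideanCLM (𝕜 := ℝ) A (EuclideanSpace.single j 1) i = A i j := by
    intro i
    have := Matrix.ofLp_toEuclideanCLM (𝕜 := ℝ) A (EuclideanSpace.single j 1)
    rw [this]
    simp
  rw [EuclideanSpace.norm_eq] at h1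
  simp only [h2, Real.norm_eq_abs] at h1
  have h3 := Real.sum_mul_le_sqrt_mul_sqrt S (fun _ => (1 : ℝ)) (fun i => |A i j|)
  simp only [one_mul, one_pow, Finset.sum_const, nsmul_eq_mul, mul_one] at h3
  refine h3.trans (mul_le_mul_of_nonneg_left (le_trans (Real.sqrt_le_sqrt ?_) h1)
    (Real.sqrt_nonneg _))
  exact Finset.sum_le_univ_sum_of_nonneg fun i => sq_nonneg _

/-- Where the sign is wrong, the entries of the two projections lie on opposite sides of zero and
differ by at least `cη`. The loss thus dominates a count of sign errors, as Assouad's method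
requires. -/
lemma sinTheta_planted_ge (hk : 1 ≤ k) (hkd : k < d) {c η : ℝ}
    (h : c ^ 2 + ((d : ℝ) - k) * η ^ 2 = 1) (hc : 0 ≤ c) (hη : 0 ≤ η) (σ : Fin d → Bool)
    (B : OrthoMat d k) :
    c * η / √((d : ℝ) - k) * ∑ i ∈ signCoords d k,
        (wrongSign (by omega) i (σ i)).indicator (fun _ => (1 : ℝ)) B ≤
      sinTheta B (planted hk hkd.le h σ) := by
  have hr : (0 : ℝ) < (d : ℝ) - k := sub_pos.2 (by exact_mod_cast hkd)
  set B' := planted hk hkd.le h σ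
  have h1 := sum_abs_col_le_opNorm (B.1 * B.1.transpose - B'.1 * B'.1.transpose)
    ⟨0, by omega⟩ (signCoords d k)
  rw [card_signCoords hkd.le, Nat.cast_sub hkd.le] at h1
  rw [div_mul_eq_mul_div, div_le_iff₀ (Real.sqrt_pos.2 hr), sinTheta, mul_comm ‖_‖]
  refine le_trans ?_ h1
  rw [Finset.mul_sum]
  refine Finset.sum_le_sum fun i hi => ?_
  have hi : k ≤ i.val := by simpa [signCoords] using hi
  rw [Matrix.sub_apply, planted_mul_transpose_apply hk hkd.le h σ hi]
  by_cases hw : B ∈ wrongSign (by omega) i (σ i)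
  · rw [Set.indicator_of_mem hw, mul_one]
    have hcη : 0 ≤ c * η := mul_nonneg hc hη
    simp only [wrongSign, Set.mem_ofPred_eq] at hw
    cases hσ : σ i
    · rw [hσ] at hw
      simp only [Bool.false_eq_true, false_iff, not_not] at hw
      refine le_trans ?_ (le_abs_self _)
      simp only [Bool.false_eq_true, if_false]
      linarith
    · rw [hσ] at hw
      simp only [true_iff, not_lt] at hw
      refine le_trans ?_ (neg_le_abs _)
      simp only [if_true]
      linarith
  · rw [Set.indicator_of_notMem hw, mul_zero]
    exact abs_nonneg _

end Planted

/-! ### Assouad's lemma -/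

section Assouad

variable {d k : ℕ} {Ω : Type*} [MeasurableSpace Ω]

/-- Flip the `i`-th sign. -/
def flipSign (i : Fin d) (σ : Fin d → Bool) : Fin d → Bool := Function.update σ i (!σ i)

lemma flipSign_flipSign (i : Fin d) (σ : Fin d → Bool) : flipSign i (flipSign i σ) = σ := by
  simp [flipSign]

lemma flipSign_apply_self (i : Fin d) (σ : Fin d → Bool) : flipSign i σ i = !σ i := by
  simp [flipSign]

/-- Neighbouring laws are too close for one test to be right under both: the error probabilities at
`σ` and at its flip sum to at least `1/2`. Averaged over the cube, each coordinate in `I` is wrong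
with probability at least `1/4`. -/
lemma assouad (hd : 0 < d) (κ : Kernel Ω (OrthoMat d k)) [IsMarkovKernel κ]
    (Q : (Fin d → Bool) → Measure Ω) [∀ σ, IsProbabilityMeasure (Q σ)] (I : Finset (Fin d))
    (hQ : ∀ σ, ∀ i ∈ I, SqDensityLE (Q σ) (Q (flipSign i σ)) (ENNReal.ofReal (5 / 4)))
    {δ S : ℝ≥0∞}
    (hS : ∀ σ, δ * ∑ i ∈ I, ∫⁻ z, κ z (wrongSign hd i (σ i)) ∂(Q σ) ≤ S) :
    δ * (I.card * 4⁻¹) ≤ S := by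
  set g : Fin d → (Fin d → Bool) → ℝ≥0∞ :=
    fun i σ => ∫⁻ z, κ z (wrongSign hd i (σ i)) ∂(Q σ) with hg
  have hmeas : ∀ i b, Measurable fun z => κ z (wrongSign (k := k) hd i b) := fun i b =>
    κ.measurable_coe (measurableSet_wrongSign hd i b)
  have hpair : ∀ i ∈ I, ∀ σ, 2⁻¹ ≤ g i σ + g i (flipSign i σ) := by
    intro i hi σ
    have h1 := (hQ σ i hi).lintegral_le (hmeas i (!σ i)) fun z => prob_le_one
    have h2 : ∫⁻ z, κ z (wrongSign hd i (σ i)) ∂(Q σ) +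
        ∫⁻ z, κ z (wrongSign hd i (!σ i)) ∂(Q σ) = 1 := by
      rw [← lintegral_add_left (hmeas i _)]
      simp_rw [wrongSign_not, prob_add_prob_compl (measurableSet_wrongSign hd i (σ i))]
      simp
    simp only [hg, flipSign_apply_self]
    have h3 : (2⁻¹ : ℝ≥0∞) + 2⁻¹ ≤ (∫⁻ z, κ z (wrongSign hd i (σ i)) ∂(Q σ) +
        ∫⁻ z, κ z (wrongSign hd i (!σ i)) ∂(Q (flipSign i σ))) + 2⁻¹ := by
      rw [ENNReal.inv_two_add_inv_two, ← h2, add_assoc]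
      gcongr
    exact (ENNReal.add_le_add_iff_right (by simp)).1 h3
  have hsum : ∀ i ∈ I, (Fintype.card (Fin d → Bool) : ℝ≥0∞) * 4⁻¹ ≤ ∑ σ, g i σ := by
    intro i hi
    have h1 : ∑ σ, g i (flipSign i σ) = ∑ σ, g i σ :=
      Fintype.sum_equiv (Function.Involutive.toPerm _ (flipSign_flipSign i)) _ _ fun σ => rfl
    have h2 : ∑ _σ : Fin d → Bool, (2⁻¹ : ℝ≥0∞) ≤ 2 * ∑ σ, g i σ := by
      rw [two_mul]
      nth_rw 2 [← h1]
      rw [← Finset.sum_add_distrib]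
      exact Finset.sum_le_sum fun σ _ => hpair i hi σ
    rw [Finset.sum_const, Finset.card_univ, nsmul_eq_mul] at h2
    have h3 : (4⁻¹ : ℝ≥0∞) = 2⁻¹ * 2⁻¹ := by
      rw [← ENNReal.mul_inv (by simp) (by simp)]; norm_num
    rw [h3, ← mul_assoc, ← div_eq_mul_inv, ENNReal.div_le_iff (by simp) (by simp), mul_comm _ 2]
    exact h2
  have hcard : (Fintype.card (Fin d → Bool) : ℝ≥0∞) ≠ 0 := by
    exact_mod_cast Fintype.card_ne_zero
  have hfin : (Fintype.card (Fin d → Bool) : ℝ≥0∞) * (δ * (I.card * 4⁻¹)) ≤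
      Fintype.card (Fin d → Bool) * S := by
    calc _ = δ * ∑ _i ∈ I, (Fintype.card (Fin d → Bool) : ℝ≥0∞) * 4⁻¹ := by
          rw [Finset.sum_const, nsmul_eq_mul]; ring
      _ ≤ δ * ∑ i ∈ I, ∑ σ, g i σ := by
          gcongr with i hi
          exact hsum i hi
      _ = ∑ σ, δ * ∑ i ∈ I, g i σ := by
          rw [Finset.sum_comm, Finset.mul_sum]
      _ ≤ ∑ _σ : Fin d → Bool, S := Finset.sum_le_sum fun σ _ => hS σ
      _ = _ := by rw [Finset.sum_const, Finset.card_univ, nsmul_eq_mul]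
  exact (ENNReal.mul_le_mul_iff_right hcard (by simp)).1 hfin

end Assouad

/-! ### From minimax risk to testing signs -/

section Reduction

variable {d k M : ℕ}

instance dataLaw.isProbabilityMeasure (B : OrthoMat d k) (α : Fin M → EuclideanSpace ℝ (Fin k))
    (n : Fin M → ℕ) : IsProbabilityMeasure (dataLaw B α n) := by
  unfold dataLaw; infer_instance

lemma risk_planted_ge (hk : 1 ≤ k) (hkd : k < d) {c η : ℝ}
    (h : c ^ 2 + ((d : ℝ) - k) * η ^ 2 = 1) (hc : 0 ≤ c) (hη : 0 ≤ η) (σ : Fin d → Bool)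
    (est : Estimator d k M) (α : Fin M → EuclideanSpace ℝ (Fin k)) (n : Fin M → ℕ) :
    ENNReal.ofReal (c * η / √((d : ℝ) - k)) * ∑ i ∈ signCoords d k,
        ∫⁻ z, est.kernel n z (wrongSign (by omega) i (σ i)) ∂(dataLaw (planted hk hkd.le h σ) α n) ≤
      risk est (planted hk hkd.le h σ) α n := by
  have hmeas : ∀ i, Measurable fun z => est.kernel n z (wrongSign (by omega) i (σ i)) := fun i =>
    (est.kernel n).measurable_coe (measurableSet_wrongSign (by omega) i (σ i))
  rw [← lintegral_finsetSum _ fun i _ => hmeas i,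
    ← lintegral_const_mul _ (Finset.measurable_sum _ fun i _ => hmeas i)]
  refine lintegral_mono fun z => ?_
  have h1 : ∀ B : OrthoMat d k, ENNReal.ofReal (c * η / √((d : ℝ) - k)) * ∑ i ∈ signCoords d k,
      (wrongSign (by omega) i (σ i)).indicator (fun _ => (1 : ℝ≥0∞)) B ≤
        ENNReal.ofReal (sinTheta B (planted hk hkd.le h σ)) := by
    intro B
    refine le_trans (le_of_eq ?_)
      (ENNReal.ofReal_le_ofReal (sinTheta_planted_ge hk hkd h hc hη σ B))
    rw [ENNReal.ofReal_mul (by positivity), ENNReal.ofReal_sum_of_nonneg fun i _ =>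
      Set.indicator_nonneg (fun _ _ => zero_le_one) _]
    congr 1
    refine Finset.sum_congr rfl fun i _ => ?_
    by_cases hB : B ∈ wrongSign (by omega) i (σ i)
    · simp [Set.indicator_of_mem hB]
    · simp [Set.indicator_of_notMem hB]
  refine le_trans (le_of_eq ?_) (lintegral_mono h1)
  have hind : ∀ i, Measurable fun B : OrthoMat d k =>
      (wrongSign (by omega) i (σ i)).indicator (fun _ => (1 : ℝ≥0∞)) B := fun i =>
    measurable_const.indicator (measurableSet_wrongSign _ _ _)
  rw [lintegral_const_mul _ (Finset.measurable_sum _ fun i _ => hind i),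
    lintegral_finsetSum _ fun i _ => hind i]
  congr 1
  refine Finset.sum_congr rfl fun i _ => ?_
  rw [lintegral_indicator (measurableSet_wrongSign _ _ _)]
  simp

/-- The law of the samples of all clients when client `i` has parameter `B (α i true)` or
`B (α i false)` with probability one half each, independently. -/
noncomputable def mixedLaw (B : OrthoMat d k) (α : Fin M → Bool → EuclideanSpace ℝ (Fin k))
    (n : Fin M → ℕ) : Measure (Dataset d n) :=
  Measure.pi fun i => halfMix fun b =>
    Measure.pi fun _ : Fin (n i) => sampleLaw (clientParam B (α i b))

instance mixedLaw.isProbabilityMeasure (B : OrthoMat d k)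
    (α : Fin M → Bool → EuclideanSpace ℝ (Fin k)) (n : Fin M → ℕ) :
    IsProbabilityMeasure (mixedLaw B α n) := by
  unfold mixedLaw; infer_instance

lemma lintegral_mixedLaw (B : OrthoMat d k) (α : Fin M → Bool → EuclideanSpace ℝ (Fin k))
    (n : Fin M → ℕ) (f : Dataset d n → ℝ≥0∞) :
    ∫⁻ z, f z ∂(mixedLaw B α n) =
      (2⁻¹ : ℝ≥0∞) ^ M * ∑ τ : Fin M → Bool, ∫⁻ z, f z ∂(dataLaw B (fun i => α i (τ i)) n) := by
  have h := pi_halfMix (fun (i : Fin M) b =>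
    Measure.pi fun _ : Fin (n i) => sampleLaw (clientParam B (α i b)))
  rw [Fintype.card_fin] at h
  rw [mixedLaw, h, lintegral_smul_measure, lintegral_finsetSum_measure]
  rfl

/-- The worst case over `α` dominates the average over all client choices `τ`, so `assouad` may be
applied to the mixed laws. The `d - k` coordinates turn the separation `cη/√(d-k)` into `cη√(d-k)`.
-/
theorem minimaxRisk_ge_of_sqDensityLE {N : ℕ} {A cD CD lam1 lamk : ℝ} (hk : 1 ≤ k) (hkd : k < d)
    {c η : ℝ} (h : c ^ 2 + ((d : ℝ) - k) * η ^ 2 = 1) (hc : 0 ≤ c) (hη : 0 ≤ η)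
    (α : Fin M → Bool → EuclideanSpace ℝ (Fin k)) (n : Fin M → ℕ)
    (hα : ∀ τ : Fin M → Bool, (fun i => α i (τ i), n) ∈ paramSpace k M N A cD CD lam1 lamk)
    (hχ : ∀ σ, ∀ i ∈ signCoords d k, SqDensityLE (mixedLaw (planted hk hkd.le h σ) α n)
      (mixedLaw (planted hk hkd.le h (flipSign i σ)) α n) (ENNReal.ofReal (5 / 4))) :
    ENNReal.ofReal (c * η * √((d : ℝ) - k) / 4) ≤ minimaxRisk d k M N A cD CD lam1 lamk := by
  refine le_iInf fun est => ?_
  set S := ⨆ B : OrthoMat d k, ⨆ p ∈ paramSpace k M N A cD CD lam1 lamk, risk est B p.1 p.2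
    with hS
  have := est.isMarkov n
  have hr : (0 : ℝ) < (d : ℝ) - k := sub_pos.2 (by exact_mod_cast hkd)
  have hle : ∀ (σ : Fin d → Bool) (τ : Fin M → Bool), risk est (planted hk hkd.le h σ) (fun i => α i (τ i)) n ≤ S := fun σ τ =>
    le_trans (le_iSup₂_of_le (f := fun p (_ : p ∈ paramSpace k M N A cD CD lam1 lamk) =>
      risk est (planted hk hkd.le h σ) p.1 p.2) _ (hα τ) le_rfl)
      (le_iSup (fun B => ⨆ p ∈ paramSpace k M N A cD CD lam1 lamk, risk est B p.1 p.2) _)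
  have hass := assouad (by omega) (est.kernel n)
    (fun σ => mixedLaw (planted hk hkd.le h σ) α n) (signCoords d k) hχ
    (δ := ENNReal.ofReal (c * η / √((d : ℝ) - k))) (S := S) fun σ => by
      simp_rw [lintegral_mixedLaw]
      rw [← Finset.mul_sum, Finset.sum_comm, mul_left_comm, Finset.mul_sum]
      calc _ ≤ (2⁻¹ : ℝ≥0∞) ^ M * ∑ _τ : Fin M → Bool, S := by
            gcongr with τ
            exact (risk_planted_ge hk hkd h hc hη σ est _ n).trans (hle σ τ)
        _ = S := by
            rw [Finset.sum_const, Finset.card_univ, nsmul_eq_mul, ← mul_assoc]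
            simp only [Fintype.card_pi, Fintype.card_bool, Finset.prod_const, Finset.card_univ,
              Fintype.card_fin, Nat.cast_pow, Nat.cast_ofNat]
            rw [← mul_pow, ENNReal.inv_mul_cancel (by simp) (by simp), one_pow, one_mul]
  refine le_trans (le_of_eq ?_) hass
  rw [card_signCoords hkd.le, show ((d - k : ℕ) : ℝ≥0∞) = ENNReal.ofReal ((d : ℝ) - k) by
      rw [← Nat.cast_sub hkd.le, ENNReal.ofReal_natCast],
    show (4⁻¹ : ℝ≥0∞) = ENNReal.ofReal 4⁻¹ by
      rw [ENNReal.ofReal_inv_of_pos (by norm_num)]; simp,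
    ← ENNReal.ofReal_mul hr.le, ← ENNReal.ofReal_mul (by positivity)]
  congr 1
  have h1 := Real.mul_self_sqrt hr.le
  have h2 := (Real.sqrt_pos.2 hr).ne'
  field_simp
  rw [sq, h1]

end Reduction

/-! ### Client parameters under the planted matrices -/

section ClientParam

variable {d k : ℕ}

/-- `plantedVec` as a vector of the Euclidean space. -/
noncomputable def plantedDir (k : ℕ) (c η : ℝ) (σ : Fin d → Bool) : EuclideanSpace ℝ (Fin d) :=
  WithLp.toLp 2 (plantedVec k c η σ)

lemma norm_plantedDir (hk : 1 ≤ k) (hkd : k ≤ d) {c η : ℝ}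
    (h : c ^ 2 + ((d : ℝ) - k) * η ^ 2 = 1) (σ : Fin d → Bool) : ‖plantedDir k c η σ‖ = 1 := by
  rw [EuclideanSpace.norm_eq]
  simp only [plantedDir, Real.norm_eq_abs, sq_abs]
  rw [sum_sq_plantedVec hk hkd, h, Real.sqrt_one]

lemma plantedDir_sub_flipSign (hk : 1 ≤ k) (c η : ℝ) (σ : Fin d → Bool) {i : Fin d}
    (hi : k ≤ i.val) :
    plantedDir k c η σ - plantedDir k c η (flipSign i σ) =
      (2 * (if σ i then η else -η)) • EuclideanSpace.single i (1 : ℝ) := by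
  ext j
  have hi0 : i.val ≠ 0 := by omega
  simp only [plantedDir, PiLp.sub_apply, PiLp.smul_apply, smul_eq_mul, plantedVec]
  by_cases hij : j = i
  · subst hij
    simp only [if_neg hi0, if_pos hi, flipSign_apply_self]
    cases σ j <;> simp <;> ring
  · have : flipSign i σ j = σ j := by simp [flipSign, hij]
    simp [this, hij]

lemma clientParam_zero (B : OrthoMat d k) : clientParam B 0 = 0 := by
  simp [clientParam]

lemma clientParam_single_zero (hk : 1 ≤ k) (hkd : k ≤ d) {c η : ℝ}
    (h : c ^ 2 + ((d : ℝ) - k) * η ^ 2 = 1) (σ : Fin d → Bool) {j : Fin k} (hj : j.val = 0)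
    (t : ℝ) :
    clientParam (planted hk hkd h σ) (EuclideanSpace.single j t) = t • plantedDir k c η σ := by
  ext i
  simp [clientParam, planted, plantedDir, plantedMatrix, hj]

/-- Clients of the other directions carry no information on the hidden signs. -/
lemma clientParam_single_ne_zero (hk : 1 ≤ k) (hkd : k ≤ d) {c η : ℝ}
    (h : c ^ 2 + ((d : ℝ) - k) * η ^ 2 = 1) (σ σ' : Fin d → Bool) {j : Fin k} (hj : j.val ≠ 0)
    (t : ℝ) :
    clientParam (planted hk hkd h σ) (EuclideanSpace.single j t) =
      clientParam (planted hk hkd h σ') (EuclideanSpace.single j t) := by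
  ext i
  simp [clientParam, planted, plantedMatrix, hj]

end ClientParam

/-! ### Assigning directions to clients -/

section Design

lemma exists_role {γ : Type*} [Fintype γ] {M : ℕ} (m : γ → ℕ) (hm : ∑ a, m a = M) :
    ∃ role : Fin M → γ, ∀ f : γ → ℝ, ∑ i, f (role i) = ∑ a, (m a : ℝ) * f a := by
  have hcard : Fintype.card (Σ a, Fin (m a)) = M := by simp [hm]
  let e := Fintype.equivFinOfCardEq hcard
  refine ⟨fun i => (e.symm i).1, fun f => ?_⟩
  rw [e.symm.sum_comp (fun x : Σ a, Fin (m a) => f x.1), Fintype.sum_sigma]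
  simp

variable {k M : ℕ}

/-- The client parameter of a client with a given role: zero, or a multiple of a coordinate
vector. -/
noncomputable def roleVec (r : Option (Fin k)) (t : ℝ) : EuclideanSpace ℝ (Fin k) :=
  r.elim 0 fun j => EuclideanSpace.single j t

/-- Coordinate vectors make the diversity matrix diagonal, and `hT` makes it exactly `cD * lamk`
times the identity. Only the squares `t i ^ 2` enter, so any choice of client signs remains
admissible. -/
lemma mem_paramSpace_of_role {N : ℕ} {A cD CD lam1 lamk : ℝ} {m : Option (Fin k) → ℕ}
    {role : Fin M → Option (Fin k)}
    (hrole : ∀ f : Option (Fin k) → ℝ, ∑ i, f (role i) = ∑ a, (m a : ℝ) * f a)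
    {sz : Option (Fin k) → ℕ} (hsz : ∀ a, 1 ≤ sz a) (hN : ∑ a, m a * sz a = N) (hN0 : 0 < N)
    {T : Fin k → ℝ} {t : Fin M → ℝ} (ht : ∀ i j, role i = some j → t i ^ 2 = T j)
    (hT : ∀ j, (m (some j) : ℝ) * (sz (some j) * T j) = N * (cD * lamk))
    (hA : 0 ≤ A) (hTA : ∀ j, T j ≤ A ^ 2) (hlam : cD * lamk ≤ CD * lam1) :
    (fun i => roleVec (role i) (t i), fun i => sz (role i)) ∈
      paramSpace k M N A cD CD lam1 lamk := by
  have hsum : ∑ i, sz (role i) = N := by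
    have := hrole fun a => (sz a : ℝ)
    rw [← hN]
    exact_mod_cast this
  have hD : diversityMatrix (fun i => roleVec (role i) (t i)) (fun i => sz (role i)) =
      (cD * lamk) • (1 : Matrix (Fin k) (Fin k) ℝ) := by
    ext x y
    let G : Option (Fin k) → ℝ := fun a => a.elim 0 fun j =>
      if x = j ∧ y = j then (sz (some j) : ℝ) * T j else 0
    have h1 : ∀ i, (sz (role i) : ℝ) * ((roleVec (role i) (t i)).ofLp x *
        (roleVec (role i) (t i)).ofLp y) = G (role i) := by
      intro i
      cases hr : role i with
      | none => simp [roleVec, G]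
      | some j =>
        simp only [G, Option.elim_some]
        rw [← ht i j hr]
        by_cases hx : x = j
        · by_cases hy : y = j
          · simp [roleVec, hx, hy, sq]
          · simp [roleVec, hy]
        · simp [roleVec, hx]
    simp only [diversityMatrix, Matrix.smul_apply, Matrix.sum_apply, Matrix.vecMulVec_apply,
      smul_eq_mul]
    have h2 : ∑ i, (sz (role i) : ℝ) * ((roleVec (role i) (t i)).ofLp x *
        (roleVec (role i) (t i)).ofLp y) = ∑ a, (m a : ℝ) * G a := by
      rw [← hrole G]
      exact Finset.sum_congr rfl fun i _ => h1 i
    rw [h2, hsum, Fintype.sum_option]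
    simp only [G, Option.elim_none, Option.elim_some, mul_zero, zero_add, Matrix.one_apply]
    have hN' : (N : ℝ) ≠ 0 := by positivity
    by_cases hxy : x = y
    · subst hxy
      rw [Finset.sum_eq_single x]
      · simp only [and_self, if_true, hT, mul_one]
        field_simp
      · intro j _ hj
        simp [Ne.symm hj]
      · simp
    · rw [Finset.sum_eq_zero]
      · simp [hxy]
      · intro j _
        rw [if_neg, mul_zero]
        rintro ⟨rfl, rfl⟩
        exact hxy rfl
  refine ⟨fun i => ?_, fun i => hsz _, hsum, ?_, ?_⟩
  · cases hr : role i with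
    | none => simpa [roleVec, hr] using hA
    | some j =>
      simp only [roleVec, hr, Option.elim_some, PiLp.norm_single, Real.norm_eq_abs]
      exact abs_le_of_sq_le_sq' ((ht i j hr).le.trans (hTA j)) hA |> abs_le.2
  · rw [hD, sub_self]
    exact Matrix.PosSemidef.zero
  · rw [hD, ← sub_smul]
    exact Matrix.PosSemidef.one.smul (sub_nonneg.2 hlam)

lemma ofReal_one_add_pow_le {x : ℝ} (hx : 0 ≤ x) {p : ℕ} (h : p * x ≤ 1 / 5) :
    ENNReal.ofReal (1 + x) ^ p ≤ ENNReal.ofReal (5 / 4) := by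
  rw [← ENNReal.ofReal_pow (by positivity)]
  apply ENNReal.ofReal_le_ofReal
  have h1 : (1 + x) ^ p ≤ Real.exp (1 / 5) := by
    calc (1 + x) ^ p ≤ Real.exp x ^ p := by
          gcongr
          linarith [Real.add_one_le_exp x]
      _ = Real.exp (p * x) := (Real.exp_nat_mul x p).symm
      _ ≤ _ := Real.exp_le_exp.2 h
  -- The value `1/5` is chosen so that `exp (1/5) ≤ 1/(1 - 1/5) = 5/4`.
  have h2 := Real.exp_bound_div_one_sub_of_interval (x := 1 / 5) (by norm_num) (by norm_num)
  refine h1.trans (h2.trans (by norm_num))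

/-- One client with parameter zero, `p` clients for the hidden direction and `q` clients for each
of the other `k - 1` directions. -/
theorem minimaxRisk_ge_of_design {d N : ℕ} {A cD CD lam1 lamk : ℝ} (hk : 1 ≤ k) (hkd : k < d)
    {c η : ℝ} (h : c ^ 2 + ((d : ℝ) - k) * η ^ 2 = 1) (hc : 0 ≤ c) (hη : 0 ≤ η)
    {p q n₀ n₁ : ℕ} (hM : 1 + p + (k - 1) * q = M) (hN : n₁ + (M - 1) * n₀ = N)
    (hn₀ : 1 ≤ n₀) (hn₁ : 1 ≤ n₁) {w : Bool → ℝ} {ω s : ℝ} (hw : ∀ b, w b ^ 2 = ω)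
    (hp : p * (n₀ * ω) = N * (cD * lamk)) (hq : q * (n₀ * s ^ 2) = N * (cD * lamk))
    (hA : 0 ≤ A) (hωA : ω ≤ A ^ 2) (hsA : s ^ 2 ≤ A ^ 2) (hlam : cD * lamk ≤ CD * lam1)
    {x : ℝ} (hx : 0 ≤ x) (hpx : p * x ≤ 1 / 5)
    (hχ : ∀ (σ : Fin d → Bool) (i : Fin d), k ≤ i.val → SqDensityLE
      (halfMix fun b => Measure.pi fun _ : Fin n₀ => sampleLaw (w b • plantedDir k c η σ))
      (halfMix fun b => Measure.pi fun _ : Fin n₀ =>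
        sampleLaw (w b • plantedDir k c η (flipSign i σ))) (ENNReal.ofReal (1 + x))) :
    ENNReal.ofReal (c * η * √((d : ℝ) - k) / 4) ≤ minimaxRisk d k M N A cD CD lam1 lamk := by
  set z : Fin k := ⟨0, hk⟩ with hz
  let m : Option (Fin k) → ℕ := fun a => a.elim 1 fun j => if j = z then p else q
  -- The zero-parameter client holds `n₁` samples and absorbs the remainder of `N`; all others hold
  -- `n₀`.
  let sz : Option (Fin k) → ℕ := fun a => a.elim n₁ fun _ => n₀
  have hsumq : ∀ f g : ℕ, ∑ j : Fin k, (if j = z then f else g) = f + (k - 1) * g := by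
    intro f g
    rw [← Finset.add_sum_erase _ _ (Finset.mem_univ z), if_pos rfl]
    congr 1
    rw [Finset.sum_congr rfl fun j hj => if_neg (Finset.ne_of_mem_erase hj), Finset.sum_const,
      Finset.card_erase_of_mem (Finset.mem_univ z), Finset.card_univ, Fintype.card_fin, smul_eq_mul]
  have hm : ∑ a, m a = M := by
    rw [Fintype.sum_option]
    simp only [m, Option.elim_none, Option.elim_some]
    rw [hsumq, ← hM]
    ring
  obtain ⟨role, hrole⟩ := exists_role m hm
  have hNsum : ∑ a, m a * sz a = N := by
    rw [Fintype.sum_option]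
    simp only [m, sz, Option.elim_none, Option.elim_some, ← Finset.sum_mul]
    rw [hsumq, ← hN, one_mul, ← hM, add_assoc 1 p, Nat.add_sub_cancel_left]
  let α : Fin M → Bool → EuclideanSpace ℝ (Fin k) := fun i b =>
    roleVec (role i) (if role i = some z then w b else s)
  refine minimaxRisk_ge_of_sqDensityLE hk hkd h hc hη α (fun i => sz (role i)) (fun τ => ?_) ?_
  · refine mem_paramSpace_of_role hrole (sz := sz) (T := fun j => if j = z then ω else s ^ 2) ?_
      hNsum (by omega) (fun i j hij => ?_) (fun j => ?_) hA (fun j => ?_) hlam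
    · intro a
      cases a <;> simpa [sz]
    · by_cases hj : j = z
      · simp [hij, hj, hw]
      · simp [hij, hj]
    · by_cases hj : j = z <;> simp [m, sz, hj, hp, hq]
    · by_cases hj : j = z <;> simp [hj, hωA, hsA]
  · intro σ i hi
    have hi : k ≤ i.val := by simpa [signCoords] using hi
    have hclient : ∀ l : Fin M, SqDensityLE
        (halfMix fun b => Measure.pi fun _ : Fin (sz (role l)) =>
          sampleLaw (clientParam (planted hk hkd.le h σ) (α l b)))
        (halfMix fun b => Measure.pi fun _ : Fin (sz (role l)) =>
          sampleLaw (clientParam (planted hk hkd.le h (flipSign i σ)) (α l b)))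
        ((fun a => if a = some z then ENNReal.ofReal (1 + x) else 1) (role l)) := by
      intro l
      simp only [α]
      generalize role l = r
      cases r with
      | none =>
        simp only [roleVec, Option.elim_none, clientParam_zero]
        exact SqDensityLE.refl _
      | some j =>
        by_cases hj : j = z
        · subst hj
          simp only [roleVec, Option.elim_some, if_true, sz]
          simp only [clientParam_single_zero hk hkd.le h _ (j := z) rfl]
          exact hχ σ i hi
        · have hj0 : j.val ≠ 0 := fun h0 => hj (Fin.ext h0)
          have hne : (some j = some z) = False := by simp [hj]
          simp only [roleVec, Option.elim_some, hne, if_false]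
          rw [clientParam_single_ne_zero hk hkd.le h σ (flipSign i σ) hj0]
          exact SqDensityLE.refl _
    refine (SqDensityLE.pi hclient).mono ?_
    -- Only these `p` clients contribute a factor other than `1` to the second moment.
    have hcount : (Finset.univ.filter fun l => role l = some z).card = p := by
      have := hrole fun a => if a = some z then 1 else 0
      simp only [Finset.sum_boole, mul_ite, mul_one, mul_zero, Finset.sum_ite_eq',
        Finset.mem_univ, if_true] at this
      simpa [m] using this
    rw [Finset.prod_ite, Finset.prod_const, Finset.prod_const_one, mul_one, hcount]
    exact ofReal_one_add_pow_le hx hpx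

end Design

/-! ### Integer allocation of clients and samples -/

section Allocation

/-- Take `n₀ = ⌊N/M⌋`, which loses at most a factor `2`. If `M < 4k`, one client per other direction
leaves `p = M - k`, a fixed fraction of `M` by the gap `ρ`. If `M ≥ 4k`, the choice `q = ⌊M/(2k)⌋`
leaves at least half of the clients for the hidden direction. -/
lemma exists_allocation {k M N : ℕ} {ρ : ℝ} (hρ : 0 < ρ) (hk : 1 ≤ k) (hM : (1 + ρ) * k ≤ M)
    (hMN : M ≤ N) :
    ∃ p q n₀ n₁ : ℕ, 1 + p + (k - 1) * q = M ∧ n₁ + (M - 1) * n₀ = N ∧ 1 ≤ p ∧ 1 ≤ q ∧ 1 ≤ n₀ ∧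
      1 ≤ n₁ ∧ M ≤ 4 * k * p ∧ M ≤ 4 * k * q ∧ N ≤ 2 * M * n₀ ∧
      min (1 / 2) (ρ / (1 + ρ)) * M ≤ p := by
  have hk' : (1 : ℝ) ≤ k := by exact_mod_cast hk
  have hkM : k < M := by
    have : (k : ℝ) < M := by nlinarith
    exact_mod_cast this
  have hM0 : 0 < M := by omega
  have hn₀ : 1 ≤ N / M := (Nat.one_le_div_iff hM0).2 hMN
  have hdm := Nat.div_add_mod N M
  have hmod := Nat.mod_lt N hM0
  have hsplit : M * (N / M) = (M - 1) * (N / M) + N / M := by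
    conv_lhs => rw [show M = (M - 1) + 1 by omega, add_mul, one_mul, show M - 1 + 1 = M by omega]
  have hN2 : N ≤ 2 * M * (N / M) := by nlinarith
  obtain ⟨l, rfl⟩ : ∃ l, k = l + 1 := ⟨k - 1, by omega⟩
  by_cases h4 : M < 4 * (l + 1)
  · refine ⟨M - (l + 1), 1, N / M, N - (M - 1) * (N / M), by simp; omega, by omega, by omega, le_rfl,
      hn₀, by omega, ?_, by omega, hN2, ?_⟩
    · have : 1 ≤ M - (l + 1) := by omega
      nlinarith
    · refine (mul_le_mul_of_nonneg_right (min_le_right _ _) (Nat.cast_nonneg M)).trans ?_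
      rw [Nat.cast_sub hkM.le, div_mul_eq_mul_div, div_le_iff₀ (by linarith)]
      linarith
  · push Not at h4
    set q := M / (2 * (l + 1)) with hq
    have hq1 : 1 ≤ q := (Nat.one_le_div_iff (by omega)).2 (by omega)
    have hdq := Nat.div_add_mod M (2 * (l + 1))
    have hmq := Nat.mod_lt M (show 0 < 2 * (l + 1) by omega)
    rw [← hq] at hdq
    have e1 : 2 * (l + 1) * q = 2 * (l * q) + 2 * q := by ring
    have hp : M ≤ 2 * (M - 1 - l * q) := by omega
    refine ⟨M - 1 - l * q, q, N / M, N - (M - 1) * (N / M), by simp; omega, by omega, by omega, hq1,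
      hn₀, by omega, ?_, ?_, hN2, ?_⟩
    · nlinarith
    · nlinarith
    · refine (mul_le_mul_of_nonneg_right (min_le_left _ _) (Nat.cast_nonneg M)).trans ?_
      have : (M : ℝ) ≤ 2 * ((M - 1 - l * q : ℕ) : ℝ) := by exact_mod_cast hp
      linarith

end Allocation

/-! ### The two lower bounds -/

section Bounds

lemma exp_le_one_add_two_mul {u : ℝ} (h0 : 0 ≤ u) (h1 : u ≤ 1 / 2) : Real.exp u ≤ 1 + 2 * u := by
  have h2 := Real.exp_bound_div_one_sub_of_interval h0 (by linarith)
  refine h2.trans ?_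
  rw [div_le_iff₀ (by linarith)]
  nlinarith

variable {d k M N : ℕ} {A cD CD lam1 lamk : ℝ}

/-- The unit-norm constraint on `plantedVec` is met by `η = ε / √(d - k)` and `c = √(1 - ε²)`. -/
lemma ofReal_eighth_le {ε : ℝ} (hkd : k < d) (hε : 0 < ε) (hε2 : ε ≤ 1 / 2) {R : ℝ≥0∞}
    (H : ∀ c η : ℝ, c ^ 2 + ((d : ℝ) - k) * η ^ 2 = 1 → 0 ≤ c → 0 ≤ η →
      η ^ 2 * ((d : ℝ) - k) = ε ^ 2 → ENNReal.ofReal (c * η * √((d : ℝ) - k) / 4) ≤ R) :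
    ENNReal.ofReal (ε / 8) ≤ R := by
  have hr : (0 : ℝ) < (d : ℝ) - k := sub_pos.2 (by exact_mod_cast hkd)
  have hη : (ε / √((d : ℝ) - k)) ^ 2 * ((d : ℝ) - k) = ε ^ 2 := by
    rw [div_pow, Real.sq_sqrt hr.le]; field_simp
  have h1 : 0 ≤ 1 - ε ^ 2 := by nlinarith
  refine le_trans ?_ (H (√(1 - ε ^ 2)) (ε / √((d : ℝ) - k)) ?_ (Real.sqrt_nonneg _)
    (by positivity) hη)
  · apply ENNReal.ofReal_le_ofReal
    have h2 : 1 / 2 ≤ √(1 - ε ^ 2) := by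
      apply Real.le_sqrt_of_sq_le; nlinarith
    have h3 := (Real.sqrt_pos.2 hr).ne'
    have h4 : √(1 - ε ^ 2) * (ε / √((d : ℝ) - k)) * √((d : ℝ) - k) = √(1 - ε ^ 2) * ε := by
      field_simp
    rw [h4]
    nlinarith
  · rw [Real.sq_sqrt h1, mul_comm, hη]; ring

/-- Since `N ≤ 2Mn₀ ≤ 8kpn₀`, the squared signal needed to meet the diversity constraint is at most
`8kX ≤ 8b`. This determines how large `A` must be. -/
lemma signal_le {X Y b : ℝ} {p n₀ : ℕ} (hk : 1 ≤ k) (hp1 : 1 ≤ p) (hn₀ : 1 ≤ n₀)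
    (hp : M ≤ 4 * k * p) (hN : N ≤ 2 * M * n₀) (hX : 0 ≤ X) (hXb : X ≤ b / k)
    (hY : p * (n₀ * Y) = N * X) : Y ≤ 8 * b := by
  have hk' : (0 : ℝ) < k := by exact_mod_cast hk
  have hp' : (0 : ℝ) < p := by exact_mod_cast hp1
  have hn' : (0 : ℝ) < n₀ := by exact_mod_cast hn₀
  have h1 : (N : ℝ) ≤ 2 * M * n₀ := by exact_mod_cast hN
  have h2 : (M : ℝ) ≤ 4 * k * p := by exact_mod_cast hp
  have h3 : X * k ≤ b := by rwa [le_div_iff₀ hk'] at hXb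
  have h4 : (N : ℝ) ≤ 8 * k * p * n₀ := by nlinarith
  have h5 : (p * n₀) * Y ≤ (p * n₀) * (8 * b) := by
    calc (p * n₀) * Y = N * X := by rw [← hY]; ring
      _ ≤ 8 * k * p * n₀ * X := by gcongr
      _ = (p * n₀) * (8 * (X * k)) := by ring
      _ ≤ _ := by gcongr
  exact le_of_mul_le_mul_left h5 (by positivity)

/-- Both values of `w` coincide, so the mixture is trivial and the divergences add up over `p n₀`
samples to order `p n₀ ω η² = Nβη²`. -/
theorem minimaxRisk_ge_known {b ρ ε : ℝ} (hk : 1 ≤ k) (hkd : k < d) (hρ : 0 < ρ)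
    (hM : (1 + ρ) * k ≤ M) (hMN : M ≤ N) (hβ : 0 < cD * lamk) (hβb : cD * lamk ≤ b / k)
    (hA : 0 ≤ A) (hbA : 8 * b ≤ A ^ 2) (hlam : cD * lamk ≤ CD * lam1) (hε : 0 < ε)
    (hε2 : ε ≤ 1 / 2) (h : 80 * (N * (cD * lamk)) * ε ^ 2 ≤ (d : ℝ) - k) :
    ENNReal.ofReal (ε / 8) ≤ minimaxRisk d k M N A cD CD lam1 lamk := by
  obtain ⟨p, q, n₀, n₁, e1, e2, hp1, hq1, hn₀, hn₁, hp, hq, hN, -⟩ := exists_allocation hρ hk hM hMN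
  have hr : (0 : ℝ) < (d : ℝ) - k := sub_pos.2 (by exact_mod_cast hkd)
  have hp' : (0 : ℝ) < p := by exact_mod_cast hp1
  have hp1' : (1 : ℝ) ≤ p := by exact_mod_cast hp1
  have hq' : (0 : ℝ) < q := by exact_mod_cast hq1
  have hn' : (0 : ℝ) < n₀ := by exact_mod_cast hn₀
  have hn1' : (1 : ℝ) ≤ n₀ := by exact_mod_cast hn₀
  set β := cD * lamk
  set ω := N * β / (p * n₀) with hω
  set s := √(N * β / (q * n₀)) with hs
  have hω0 : 0 ≤ ω := by positivity
  have hs2 : s ^ 2 = N * β / (q * n₀) := Real.sq_sqrt (by positivity)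
  have hpω : p * (n₀ * ω) = N * β := by rw [hω]; field_simp
  have hqs : q * (n₀ * s ^ 2) = N * β := by rw [hs2]; field_simp
  refine ofReal_eighth_le hkd hε hε2 fun c η hcη hc hη hηε => ?_
  -- Here `80 = 5 · 16`. The `16` arises from `exp (8 n₀ ω η²) ≤ 1 + 16 n₀ ω η²`.
  have hx : p * (16 * (n₀ * ω) * η ^ 2) ≤ 1 / 5 := by
    have h1 : p * (16 * (n₀ * ω) * η ^ 2) * ((d : ℝ) - k) ≤ 1 / 5 * ((d : ℝ) - k) := by
      calc _ = 16 * (p * (n₀ * ω)) * (η ^ 2 * ((d : ℝ) - k)) := by ring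
        _ ≤ _ := by rw [hpω, hηε]; linarith
    exact le_of_mul_le_mul_right h1 hr
  have hx' : 16 * (n₀ * ω) * η ^ 2 ≤ 1 / 5 := by
    refine le_trans ?_ hx
    exact le_mul_of_one_le_left (by positivity) hp1'
  have hx'' : 16 * ω * η ^ 2 ≤ 1 / 5 := by
    refine le_trans ?_ hx'
    have : ω ≤ n₀ * ω := le_mul_of_one_le_left hω0 hn1'
    gcongr
  refine minimaxRisk_ge_of_design hk hkd hcη hc hη e1 e2 hn₀ hn₁ (w := fun _ => √ω) (ω := ω)
    (s := s) (fun _ => Real.sq_sqrt hω0) hpω hqs hA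
    ((signal_le hk hp1 hn₀ hp hN hβ.le hβb hpω).trans hbA)
    ((signal_le hk hq1 hn₀ hq hN hβ.le hβb hqs).trans hbA) hlam
    (x := 16 * (n₀ * ω) * η ^ 2) (by positivity) hx ?_
  intro σ i hi
  have hmix : ∀ ν : Measure (Fin n₀ → EuclideanSpace ℝ (Fin d) × ℝ),
      halfMix (fun _ => ν) = ν := by
    intro ν
    rw [halfMix, ← two_smul ℝ≥0∞ ν, smul_smul, ENNReal.inv_mul_cancel (by simp) (by simp), one_smul]
  rw [hmix, hmix]
  have hsq : ∀ t : Bool, (√ω * (2 * (if t then η else -η))) ^ 2 = 4 * ω * η ^ 2 := by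
    intro t
    rw [mul_pow, Real.sq_sqrt hω0]
    cases t <;> simp <;> ring
  have hsub : √ω • plantedDir k c η σ - √ω • plantedDir k c η (flipSign i σ) =
      (√ω * (2 * (if σ i then η else -η))) • EuclideanSpace.single i (1 : ℝ) := by
    rw [← smul_sub, plantedDir_sub_flipSign hk c η σ hi, smul_smul]
  have hone : SqDensityLE (sampleLaw (√ω • plantedDir k c η σ))
      (sampleLaw (√ω • plantedDir k c η (flipSign i σ)))
      (ENNReal.ofReal (Real.exp (2 * (4 * ω * η ^ 2)))) := by
    rw [← hsq (σ i)]
    exact SqDensityLE.sampleLaw (by simp) hsub (by rw [hsq]; linarith)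
  refine (SqDensityLE.pi fun _ : Fin n₀ => hone).mono ?_
  rw [Finset.prod_const, Finset.card_univ, Fintype.card_fin,
    ← ENNReal.ofReal_pow (Real.exp_pos _).le, ← Real.exp_nat_mul]
  apply ENNReal.ofReal_le_ofReal
  refine (exp_le_one_add_two_mul (by positivity) (by linarith)).trans (le_of_eq (by ring))

/-- The total divergence is of order `p (n₀ω)² η² = (Nβ)²η²/p`, so spreading the signal over `p ≥
κM` clients weakens it. The parameter `y` bounds `n₀ω` and keeps the exponential prefactor under
control. -/
theorem minimaxRisk_ge_unknown {b ρ ε κ y : ℝ} (hk : 1 ≤ k) (hkd : k < d) (hρ : 0 < ρ)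
    (hM : (1 + ρ) * k ≤ M) (hMN : M ≤ N) (hβ : 0 < cD * lamk) (hβb : cD * lamk ≤ b / k)
    (hA : 0 ≤ A) (hbA : 8 * b ≤ A ^ 2) (hlam : cD * lamk ≤ CD * lam1) (hε : 0 < ε)
    (hε2 : ε ≤ 1 / 2) (hκ : κ = min (1 / 2) (ρ / (1 + ρ))) (hβκ : 72 * (cD * lamk) ≤ κ)
    (hy : N * (cD * lamk) ≤ y * (κ * M))
    (h : 11520 * Real.exp (1 / 4 + 9 * y) * (N * (cD * lamk)) ^ 2 * ε ^ 2 ≤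
      κ * M * ((d : ℝ) - k)) :
    ENNReal.ofReal (ε / 8) ≤ minimaxRisk d k M N A cD CD lam1 lamk := by
  obtain ⟨p, q, n₀, n₁, e1, e2, hp1, hq1, hn₀, hn₁, hp, hq, hN, hpκ⟩ :=
    exists_allocation hρ hk hM hMN
  rw [← hκ] at hpκ
  have hκ0 : 0 < κ := by rw [hκ]; positivity
  have hr : (0 : ℝ) < (d : ℝ) - k := sub_pos.2 (by exact_mod_cast hkd)
  have hp' : (0 : ℝ) < p := by exact_mod_cast hp1
  have hq' : (0 : ℝ) < q := by exact_mod_cast hq1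
  have hn' : (0 : ℝ) < n₀ := by exact_mod_cast hn₀
  have hM0 : (0 : ℝ) < M := by exact_mod_cast (show 0 < M by omega)
  have hN' : (N : ℝ) ≤ 2 * M * n₀ := by exact_mod_cast hN
  set β := cD * lamk
  set ω := N * β / (p * n₀) with hω
  set s := √(N * β / (q * n₀)) with hs
  have hω0 : 0 ≤ ω := by positivity
  have hs2 : s ^ 2 = N * β / (q * n₀) := Real.sq_sqrt (by positivity)
  have hpω : p * (n₀ * ω) = N * β := by rw [hω]; field_simp
  have hqs : q * (n₀ * s ^ 2) = N * β := by rw [hs2]; field_simp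
  -- From `N ≤ 2Mn₀` and `κM ≤ p` one gets `ω ≤ 2β/κ`; hence the `72 = 2 · 36` in `hβκ`.
  have hω36 : ω ≤ 1 / 36 := by
    rw [hω, div_le_iff₀ (by positivity)]
    calc (N : ℝ) * β ≤ 2 * M * n₀ * β := by gcongr
      _ = M * n₀ * (72 * β) / 36 := by ring
      _ ≤ M * n₀ * κ / 36 := by gcongr
      _ = (κ * M) * n₀ / 36 := by ring
      _ ≤ p * n₀ / 36 := by gcongr
      _ = _ := by ring
  have hy0 : 0 ≤ y := by
    by_contra hneg
    push Not at hneg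
    have h1 : y * (κ * M) ≤ 0 := mul_nonpos_of_nonpos_of_nonneg hneg.le (by positivity)
    have h2 : 0 < (N : ℝ) * β := mul_pos (lt_of_lt_of_le hM0 (by exact_mod_cast hMN)) hβ
    linarith
  have hnω : n₀ * ω ≤ y := by
    have h1 : p * (n₀ * ω) ≤ p * y := by
      rw [hpω]
      refine hy.trans ?_
      rw [mul_comm (p : ℝ)]
      gcongr
    exact le_of_mul_le_mul_left h1 hp'
  refine ofReal_eighth_le hkd hε hε2 fun c η hcη hc hη hηε => ?_
  have hx : p * (2304 * Real.exp (1 / 4 + 9 * y) * ((n₀ * ω) ^ 2 * η ^ 2)) ≤ 1 / 5 := by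
    have h1 : p * (2304 * Real.exp (1 / 4 + 9 * y) * ((n₀ * ω) ^ 2 * η ^ 2)) *
        (p * ((d : ℝ) - k)) ≤ 1 / 5 * (p * ((d : ℝ) - k)) := by
      calc _ = 2304 * Real.exp (1 / 4 + 9 * y) * (p * (n₀ * ω)) ^ 2 * (η ^ 2 * ((d : ℝ) - k)) := by
            ring
        _ = 1 / 5 * (11520 * Real.exp (1 / 4 + 9 * y) * (N * β) ^ 2 * ε ^ 2) := by
            rw [hpω, hηε]; ring
        _ ≤ 1 / 5 * (κ * M * ((d : ℝ) - k)) := by gcongr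
        _ ≤ _ := by gcongr
    exact le_of_mul_le_mul_right h1 (by positivity)
  refine minimaxRisk_ge_of_design hk hkd hcη hc hη e1 e2 hn₀ hn₁
    (w := fun t => if t then √ω else -√ω) (ω := ω)
    (s := s) (fun t => by cases t <;> simp [Real.sq_sqrt hω0]) hpω hqs hA
    ((signal_le hk hp1 hn₀ hp hN hβ.le hβb hpω).trans hbA)
    ((signal_le hk hq1 hn₀ hq hN hβ.le hβb hqs).trans hbA) hlam
    (x := 2304 * Real.exp (1 / 4 + 9 * y) * ((n₀ * ω) ^ 2 * η ^ 2)) (by positivity) hx ?_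
  intro σ i hi
  have hmix : ∀ v : EuclideanSpace ℝ (Fin d), (halfMix fun t => Measure.pi fun _ : Fin n₀ =>
      sampleLaw ((if t then √ω else -√ω) • v)) = signMix n₀ (√ω • v) := by
    intro v
    rw [signMix]
    congr 1
    funext t
    cases t <;> simp
  rw [hmix, hmix]
  refine (SqDensityLE.signMix hn₀ (norm_plantedDir hk hkd.le hcη σ)
    (norm_plantedDir hk hkd.le hcη _) (by simp) (plantedDir_sub_flipSign hk c η σ hi)
    (by rwa [Real.sq_sqrt hω0])).mono (ENNReal.ofReal_le_ofReal ?_)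
  have hw4 : √ω ^ 4 = ω ^ 2 := by
    rw [show 4 = 2 * 2 by norm_num, pow_mul, Real.sq_sqrt hω0]
  have hη2 : (if σ i then η else -η) ^ 2 = η ^ 2 := by cases σ i <;> simp
  rw [hw4, hη2, Real.sq_sqrt hω0, mul_pow]
  gcongr

end Bounds

/-! ### Combining the two bounds -/

lemma exists_pos_sq_le {t : ℝ} (ht : 0 < t) : ∃ c : ℝ, 0 < c ∧ c ≤ 1 / 2 ∧ c ^ 2 ≤ t := by
  refine ⟨min (1 / 2) (√t), by positivity, min_le_left _ _, ?_⟩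
  calc _ ≤ √t ^ 2 := by gcongr; exact min_le_right _ _
    _ = t := Real.sq_sqrt ht.le

lemma mul_min_sq_le {c X : ℝ} (hX : 0 ≤ X) : (c * min X 1) ^ 2 ≤ c ^ 2 * X ^ 2 := by
  rw [mul_pow]
  have : 0 ≤ min X 1 := le_min hX zero_le_one
  gcongr
  exact min_le_left _ _

lemma min_add_le {X Y G : ℝ} (hX : 0 ≤ X) (hG : 1 ≤ G) (h : Y ≤ G * X) :
    min (X + Y) 1 ≤ 2 * G * min X 1 := by
  rcases le_total X 1 with h1 | h1
  · rw [min_eq_left h1]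
    refine (min_le_left _ _).trans ?_
    nlinarith
  · rw [min_eq_right h1]
    exact (min_le_right _ _).trans (by linarith)

theorem mainTheorem6 (b cD : ℝ) (hb : 0 < b) (hcD : 0 < cD) :
    ∃ A₀ : ℝ, 0 < A₀ ∧ ∀ A : ℝ, A₀ ≤ A →
      ∀ a CD c₀ ρ₁ ρ₂ : ℝ, 0 < a → cD ≤ CD → 0 < c₀ → 0 < ρ₁ → 0 < ρ₂ →
        ∃ c : ℝ, 0 < c ∧
          ∀ (d k M N : ℕ) (lam1 lamk : ℝ),
            1 ≤ k →
            c₀ * Real.log M ≤ k →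
            (1 + ρ₁) * k ≤ d →
            (1 + ρ₂) * k ≤ M →
            M ≤ N →
            a / k ≤ lamk → lamk ≤ lam1 → lam1 ≤ b / k →
            ENNReal.ofReal
                (c * min (√((d : ℝ) * k / N) + √((M : ℝ) * d * (k : ℝ) ^ 2 / (N : ℝ) ^ 2)) 1)
              ≤ minimaxRisk d k M N A cD CD lam1 lamk := by
  set K := cD * b with hK
  have hK0 : 0 < K := mul_pos hcD hb
  -- Then `A ≥ 1` and `A ≥ 8K`, so `A² ≥ 8K`.
  refine ⟨8 * K + 1, by positivity, fun A hA a CD c₀ ρ₁ ρ₂ ha hCD _ hρ₁ hρ₂ => ?_⟩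
  have hA0 : 0 ≤ A := by linarith
  have hKA : 8 * K ≤ A ^ 2 := by nlinarith
  set κ := min (1 / 2) (ρ₂ / (1 + ρ₂)) with hκ
  have hκ0 : 0 < κ := by positivity
  set κ₁ := ρ₁ / (1 + ρ₁) with hκ₁
  have hκ₁0 : 0 < κ₁ := by positivity
  -- For `k ≥ k₀` the signal condition `72 * (cD * lamk) ≤ κ` follows from `cD * lamk ≤ K/k`.
  set k₀ := 72 * K / κ with hk₀
  have hk₀0 : 0 < k₀ := by positivity
  set E := Real.exp (1 / 4 + 9 * (K / κ)) with hE
  have hE0 : 0 < E := Real.exp_pos _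
  obtain ⟨c₁, hc₁, hc₁2, hc₁s⟩ := exists_pos_sq_le (t := κ₁ / (80 * K)) (by positivity)
  obtain ⟨c₂, hc₂, hc₂2, hc₂s⟩ := exists_pos_sq_le (t := κ * κ₁ / (11520 * E * K ^ 2)) (by positivity)
  -- For `k < k₀` and `M ≤ N`, `Y² = X² · Mk/N` gives `Y ≤ √k₀ · X`. Hence `Y > G X` rules out small
  -- `k`, and it also forces `X < Y`.
  set G := 1 + √k₀ with hG
  have hG1 : 1 ≤ G := by rw [hG]; linarith [Real.sqrt_nonneg k₀]
  -- The factor `16 G` is `8`, from `ε/8` in both bounds, times `2G` from `min_add_le`.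
  refine ⟨min c₁ c₂ / (16 * G), by positivity, ?_⟩
  clear_value K κ κ₁ k₀ E G
  intro d k M N lam1 lamk hk _ hd hM hMN hak hlam hbk
  have hk' : (1 : ℝ) ≤ k := by exact_mod_cast hk
  have hk0 : (0 : ℝ) < k := by linarith
  have hkd : k < d := by
    have : (k : ℝ) < d := by nlinarith
    exact_mod_cast this
  have hd0 : (0 : ℝ) < d := by exact_mod_cast (show 0 < d by omega)
  have hM0 : (0 : ℝ) < M := lt_of_lt_of_le (by positivity) hM
  have hMN' : (M : ℝ) ≤ N := by exact_mod_cast hMN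
  have hN0 : (0 : ℝ) < N := by linarith
  have hlamk0 : 0 < lamk := lt_of_lt_of_le (by positivity) hak
  have hβ : 0 < cD * lamk := by positivity
  have hβK : cD * lamk ≤ K / k := by
    rw [hK, mul_div_assoc]; gcongr; linarith
  have hβlam : cD * lamk ≤ CD * lam1 :=
    mul_le_mul hCD hlam hlamk0.le (hcD.le.trans hCD)
  have hr : κ₁ * d ≤ (d : ℝ) - k := by
    rw [hκ₁, div_mul_eq_mul_div, div_le_iff₀ (by linarith)]
    nlinarith
  set X := √((d : ℝ) * k / N) with hX
  set Y := √((M : ℝ) * d * (k : ℝ) ^ 2 / (N : ℝ) ^ 2) with hY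
  have hX0 : 0 < X := by positivity
  have hY0 : 0 < Y := by positivity
  have hX2 : X ^ 2 = (d : ℝ) * k / N := Real.sq_sqrt (by positivity)
  have hY2 : Y ^ 2 = (M : ℝ) * d * (k : ℝ) ^ 2 / (N : ℝ) ^ 2 := Real.sq_sqrt (by positivity)
  have hYX : Y ^ 2 = X ^ 2 * (M * k / N) := by rw [hX2, hY2]; field_simp
  clear_value X Y
  have hle : ∀ (Z : ℝ) {c : ℝ}, 0 < c → c ≤ 1 / 2 → c * min Z 1 ≤ 1 / 2 := fun Z c h0 h1 =>
    (mul_le_of_le_one_right h0.le (min_le_right _ _)).trans h1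
  have hpos : ∀ {Z c : ℝ}, 0 < Z → 0 < c → 0 < c * min Z 1 := fun hZ hc =>
    mul_pos hc (lt_min hZ one_pos)
  by_cases hcase : Y ≤ G * X
  · have hε : 80 * (N * (cD * lamk)) * (c₁ * min X 1) ^ 2 ≤ (d : ℝ) - k := by
      calc _ ≤ 80 * (N * (K / k)) * (κ₁ / (80 * K) * X ^ 2) := by
            gcongr
            exact (mul_min_sq_le hX0.le).trans (by gcongr)
        _ = κ₁ * d := by rw [hX2]; field_simp
        _ ≤ _ := hr
    have hknown := minimaxRisk_ge_known (A := A) (CD := CD) (lam1 := lam1) (ε := c₁ * min X 1)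
      hk hkd hρ₂ hM hMN hβ hβK hA0 hKA hβlam (hpos hX0 hc₁)
      (hle X hc₁ hc₁2) hε
    refine le_trans (ENNReal.ofReal_le_ofReal ?_) hknown
    have h1 := min_add_le hX0.le hG1 hcase
    calc _ ≤ c₁ / (16 * G) * (2 * G * min X 1) := by
          gcongr
          exact min_le_left _ _
      _ = _ := by field_simp; ring
  · push Not at hcase
    have hXY : X < Y := (le_mul_of_one_le_left hX0.le hG1).trans_lt hcase
    -- This is what bounds `n₀ω`: it yields `N * (cD * lamk) ≤ M * K`, so `y = K/κ` works.
    have hNMk : (N : ℝ) ≤ M * k := by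
      by_contra hneg
      push Not at hneg
      have h1 : (M * k : ℝ) / N ≤ 1 := by rw [div_le_one hN0]; exact hneg.le
      have h2 : Y ^ 2 ≤ X ^ 2 := by
        rw [hYX]; exact mul_le_of_le_one_right (sq_nonneg _) h1
      exact hXY.not_ge (abs_le_of_sq_le_sq' h2 hX0.le).2
    have hkk₀ : k₀ ≤ k := by
      by_contra hneg
      push Not at hneg
      have h1 : (M * k : ℝ) / N ≤ k₀ := by
        rw [div_le_iff₀ hN0, mul_comm k₀]
        exact mul_le_mul hMN' hneg.le hk0.le hN0.le
      have h2 : Y ^ 2 ≤ (√k₀ * X) ^ 2 := by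
        rw [hYX, mul_pow, Real.sq_sqrt hk₀0.le, mul_comm k₀]; gcongr
      have h3 : Y ≤ √k₀ * X := (abs_le_of_sq_le_sq' h2 (by positivity)).2
      rw [hG, add_mul, one_mul] at hcase
      linarith
    have hunknown := minimaxRisk_ge_unknown (A := A) (CD := CD) (lam1 := lam1)
      (ε := c₂ * min Y 1) (y := K / κ)
      hk hkd hρ₂ hM hMN hβ hβK hA0 hKA hβlam (hpos hY0 hc₂)
      (hle Y hc₂ hc₂2) hκ
      (by
        rw [hk₀, div_le_iff₀ hκ0] at hkk₀
        calc _ ≤ 72 * (K / k) := by gcongr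
          _ = 72 * K / k := by ring
          _ ≤ κ := by rw [div_le_iff₀ hk0]; linarith)
      (by
        calc _ ≤ (M * k) * (K / k) := by gcongr
          _ = _ := by field_simp)
      (by
        rw [← hE]
        calc _ ≤ 11520 * E * (N * (K / k)) ^ 2 * (κ * κ₁ / (11520 * E * K ^ 2) * Y ^ 2) := by
              gcongr
              exact (mul_min_sq_le hY0.le).trans (by gcongr)
          _ = κ * M * (κ₁ * d) := by rw [hY2]; field_simp
          _ ≤ _ := by gcongr)
    refine le_trans (ENNReal.ofReal_le_ofReal ?_) hunknown
    have h1 := min_add_le hY0.le hG1 (hXY.le.trans (le_mul_of_one_le_left hY0.le hG1))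
    rw [add_comm Y] at h1
    calc _ ≤ c₂ / (16 * G) * (2 * G * min Y 1) := by
          gcongr
          exact min_le_right _ _
      _ = _ := by field_simp; ring
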